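/- There are effective complete well-structured transition systems (WSTS) $\mathfrak S$, namely completions of functional-lossy channel systems, whose clover map $Clover_{\mathfrak S} : S \to \mathbb P_{\rm fin}(S)$ is not recursive. In detail: there exist a finite set $Q$ of control states, a number $k$ of channels, a finite alphabet $\Sigma$, and a functional-lossy channel system $\mathfrak X$ over $Q$, $k$, $\Sigma$ such that its completion $\mathfrak S=\widehat{\mathfrak X}$ is a complete WSTS, $\mathfrak S$ is effective with respect to the representation of its states by word-products, and $Clover_{\mathfrak S}$ is not recursive with respect to this representation. The notions are the following. * A functional-lossy channel system is a finite set of transitions $(p, op, p')$ with $p,p'\in Q$, where $op$ is either "send the letter $a$ to channel $c$" or "receive the letter $a$ from channel $c$". Its states form the poset $X = Q\times(\Sigma^*)^k$, ordered by equality on $Q$ and the (scattered) subword ordering on each channel. Each transition defines a partial map on $X$, which leads from control state $p$ to control state $p'$: sending $a$ is always possible and replaces the content $w$ of channel $c$ by $wa$; receiving $a$ is possible iff $a$ occurs in channel $c$, and replaces its content $waw'$, where $a$ does not occur in $w$, by $w'$. * The completion $\mathfrak S$ has as states the set $S$ of ideals (non-empty directed downward-closed subsets) of $X$, ordered by inclusion.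 Each partial map $f$ of $\mathfrak X$ gives a partial map $\hat f$ of $\mathfrak S$, which is defined on the ideals $C$ with $C\cap \mathrm{dom} f\ne\emptyset$, by $\hat f(C) = {\downarrow} f\langle C\rangle$. Write $F$ for the finite set of these maps $\hat f$. * $\mathfrak S$ is a complete WSTS if $S$ is a well partial order and a continuous dcpo, and every map in $F$ is partial monotonic (its domain is upward-closed and it is monotonic there) and partial continuous (its domain is Scott-open and it preserves least upper bounds of directed subsets of its domain). * $Cover_{\mathfrak S}(s)={\downarrow}Post^*_{\mathfrak S}({\downarrow} s)$, and $Clover_{\mathfrak S}(s)$ is the set of maximal elements of the set of all least upper bounds of directed subsets of $Cover_{\mathfrak S}(s)$. * A word-product is a finite concatenation of atomic expressions $a^?$ (the language $\{\varepsilon,a\}$, with $a\in\Sigma$) and $A^*$ (with $A\subseteq\Sigma$). A tuple $(q,P_1,\dots,P_k)$ of a control state and $k$ word-products represents the ideal of all $(q,w_1,\dots,w_k)$ such that each $w_i$ is in the language of $P_i$. Codes of states are the natural numbers that encode such tuples in a standard way. * $\mathfrak S$ is effective with respect to this representation if every state has a code; the ordering is decidable on codes; for each $f\in F$, one can decide from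 a code of $s$ whether $s\in\mathrm{dom} f$, and compute a code of $f(s)$ if so; and a finite list of codes of the immediate successors of $s$ can be computed from a code of $s$. $Clover_{\mathfrak S}$ is recursive with respect to it if there is a partial recursive function which is defined on all codes and maps each code of each state $s$ to a finite list of codes whose set of represented states is $Clover_{\mathfrak S}(s)$. -/

import Mathlib

namespace WSTS

/-! ### Order theory: directed sets, dcpos, continuity -/

section OrderTheory

variable {S : Type*} [PartialOrder S]

/-- Non-empty directed subsets. -/
def IsDirSet (D : Set S) : Prop := D.Nonempty ∧ DirectedOn (· ≤ ·) D

/-- `S` is a dcpo: every (non-empty) directed subset has a least upper bound. -/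
def IsDcpo (S : Type*) [PartialOrder S] : Prop :=
  ∀ D : Set S, IsDirSet D → ∃ x, IsLUB D x

/-- The way-below relation `x ≪ y`. -/
def WayBelow (x y : S) : Prop :=
  ∀ (D : Set S) (d : S), IsDirSet D → IsLUB D d → y ≤ d → ∃ z ∈ D, x ≤ z

/-- Every element is the directed least upper bound of the elements way below it. -/
def IsContinuousPoset (S : Type*) [PartialOrder S] : Prop :=
  ∀ x : S, IsDirSet {y | WayBelow y x} ∧ IsLUB {y | WayBelow y x} x

/-- Continuous directed complete well orders: continuous dcpos whose ordering is well. -/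
def IsContinuousDcwo (S : Type*) [PartialOrder S] : Prop :=
  IsDcpo S ∧ IsContinuousPoset S ∧ WellQuasiOrderedLE S

/-- Scott-open sets. -/
def IsScottOpen (U : Set S) : Prop :=
  IsUpperSet U ∧ ∀ (D : Set S) (d : S), IsDirSet D → IsLUB D d → d ∈ U → ∃ z ∈ D, z ∈ U

/-- `Lub E`: the least upper bounds of the directed subsets of `E`. -/
def lubSet (E : Set S) : Set S := {x | ∃ D ⊆ E, IsDirSet D ∧ IsLUB D x}

/-- `Max E`: the maximal elements of `E`. -/
def maxSet (E : Set S) : Set S := {x | Maximal (· ∈ E) x}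

/-- Partial monotonic maps: the domain is upward-closed and the map is monotonic on it. -/
def IsPartialMonotone (f : S →. S) : Prop :=
  IsUpperSet f.Dom ∧ ∀ x y x' y', x ≤ y → x' ∈ f x → y' ∈ f y → x' ≤ y'

/-- Partial continuous maps: the domain is Scott-open, and the map preserves least upper bounds
of directed subsets of its domain. -/
def IsPartialContinuous (f : S →. S) : Prop :=
  IsScottOpen f.Dom ∧
    ∀ (D : Set S) (d : S), IsDirSet D → D ⊆ f.Dom → IsLUB D d →
      ∃ d' ∈ f d, IsLUB (f.image D) d'

end OrderTheory

/-! ### Ordered functional transition systems, complete WSTS, clovers -/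

/-- An ordered functional transition system on the poset `S`: a finite set of partial monotonic
maps. -/
structure FunctionalTS (S : Type*) [PartialOrder S] where
  maps : Set (S →. S)
  finite_maps : maps.Finite
  monotone_maps : ∀ f ∈ maps, IsPartialMonotone f

namespace FunctionalTS

variable {S : Type*} [PartialOrder S] (T : FunctionalTS S)

/-- The transition relation. -/
def Step (s s' : S) : Prop := ∃ f ∈ T.maps, s' ∈ f s

/-- The set of immediate successors. -/
def post (s : S) : Set S := {s' | T.Step s s'}

/-- The reachability set. -/
def postStar (s : S) : Set S := {s' | Relation.ReflTransGen T.Step s s'}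

/-- The cover `↓ Post* (↓ s)`. -/
def cover (s : S) : Set S := {t | ∃ s₁ ≤ s, ∃ s₂ ∈ T.postStar s₁, t ≤ s₂}

/-- The clover `Max (Lub (Cover s))`. -/
def clover (s : S) : Set S := maxSet (lubSet (T.cover s))

/-- Complete WSTS: the state space is a continuous dcwo, and all maps are partial continuous. -/
def IsCompleteWSTS : Prop :=
  IsContinuousDcwo S ∧ ∀ f ∈ T.maps, IsPartialContinuous f

end FunctionalTS

/-! ### Effectivity

States are coded by natural numbers, through a partial map `r : ℕ →. S`; the set of codes is the
domain of `r`, and `e` is a code of `s` when `s ∈ r e`. -/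

section Effectivity

variable {S : Type*}

/-- `r` is a representation map: every state has a code. -/
def IsRepresentation (r : ℕ →. S) : Prop := ∀ s, ∃ e, s ∈ r e

/-- The relation `R` on states is decidable on codes. -/
def IsDecidableVia (r : ℕ →. S) (R : S → S → Prop) : Prop :=
  ∃ d : ℕ × ℕ →. Bool, Partrec d ∧
    ∀ e e' s s', s ∈ r e → s' ∈ r e' → ∃ b ∈ d (e, e'), (b = true ↔ R s s')

/-- The partial map `f` on states is computable: given a code of `s`, one can decide whether
`s ∈ dom f` (the output is `none` if not), and compute a code of `f s` in this case. -/
def IsComputableVia (r : ℕ →. S) (f : S →. S) : Prop :=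
  ∃ g : ℕ →. Option ℕ, Partrec g ∧
    ∀ e s, s ∈ r e →
      (none ∈ g e ∧ s ∉ f.Dom) ∨ ∃ e' s', some e' ∈ g e ∧ s' ∈ r e' ∧ s' ∈ f s

/-- The map `Φ` from states to finite sets of states is recursive: there is a partial recursive
map, defined on all codes, that maps every code of `s` to a list of codes which represents the
set `Φ s`. -/
def IsSetRecursiveVia (r : ℕ →. S) (Φ : S → Set S) : Prop :=
  ∃ g : ℕ →. List ℕ, Partrec g ∧
    ∀ e s, s ∈ r e →
      ∃ l ∈ g e, (∀ e' ∈ l, (r e').Dom) ∧ {t | ∃ e' ∈ l, t ∈ r e'} = Φ s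

/-- Effective ordered functional transition systems, with respect to the representation `r`. -/
def FunctionalTS.IsEffectiveVia [PartialOrder S] (T : FunctionalTS S) (r : ℕ →. S) : Prop :=
  IsRepresentation r ∧ IsDecidableVia r (· ≤ ·) ∧ (∀ f ∈ T.maps, IsComputableVia r f) ∧
    IsSetRecursiveVia r T.post

end Effectivity

/-! ### Completions -/

section Completion

variable {X : Type*} [PartialOrder X]

/-- The extension of a partial monotonic map `f` to ideals: it is defined on the ideals `C` that
meet `dom f`, and maps `C` to the downward closure of the image of `C` under `f`. -/
def soberMap (f : X →. X) (hf : IsPartialMonotone f) : Order.Ideal X →. Order.Ideal X :=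
  fun C =>
    { Dom := ((C : Set X) ∩ f.Dom).Nonempty
      get := fun h =>
        { carrier := {y | ∃ x ∈ C, ∃ x' ∈ f x, y ≤ x'}
          lower' := fun _ _ hba ⟨x, hx, x', hx', h'⟩ => ⟨x, hx, x', hx', hba.trans h'⟩
          nonempty' := by
            obtain ⟨x, hx, hd⟩ := h
            exact ⟨(f x).get hd, x, hx, _, Part.get_mem hd, le_rfl⟩
          directed' := by
            rintro y ⟨x, hx, x', hx', hy⟩ z ⟨w, hw, w', hw', hz⟩
            obtain ⟨v, hv, hxv, hwv⟩ := C.directed x hx w hw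
            have hd : v ∈ f.Dom := hf.1 hxv (Part.dom_iff_mem.2 ⟨x', hx'⟩)
            have hg := Part.get_mem hd
            exact ⟨(f v).get hd, ⟨v, hv, _, hg, le_rfl⟩,
              hy.trans (hf.2 _ _ _ _ hxv hx' hg), hz.trans (hf.2 _ _ _ _ hwv hw' hg)⟩ } }

theorem mem_soberMap {f : X →. X} {hf : IsPartialMonotone f} {C D : Order.Ideal X} :
    D ∈ soberMap f hf C ↔
      ((C : Set X) ∩ f.Dom).Nonempty ∧ (D : Set X) = {y | ∃ x ∈ C, ∃ x' ∈ f x, y ≤ x'} := by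
  constructor
  · rintro ⟨h, rfl⟩
    exact ⟨h, rfl⟩
  · rintro ⟨h, hD⟩
    exact ⟨h, SetLike.coe_injective hD.symm⟩

theorem isPartialMonotone_soberMap (f : X →. X) (hf : IsPartialMonotone f) :
    IsPartialMonotone (soberMap f hf) := by
  refine ⟨fun C D hCD ⟨x, hx, hd⟩ => ⟨x, hCD hx, hd⟩, fun C D C' D' hCD hC hD => ?_⟩
  rw [mem_soberMap] at hC hD
  rw [← SetLike.coe_subset_coe, hC.2, hD.2]
  rintro y ⟨x, hx, h⟩
  exact ⟨x, hCD hx, h⟩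

/-- The completion of an ordered functional transition system: the states are the ideals, ordered
by inclusion, and the maps are the extensions of the given maps to ideals. -/
def FunctionalTS.completion (T : FunctionalTS X) : FunctionalTS (Order.Ideal X) where
  maps := Set.range fun f : T.maps => soberMap f.1 (T.monotone_maps f.1 f.2)
  finite_maps := by
    have := T.finite_maps.to_subtype
    exact Set.finite_range _
  monotone_maps := by
    rintro _ ⟨f, rfl⟩
    exact isPartialMonotone_soberMap _ _

end Completion

/-! ### Functional-lossy channel systems -/

/-- Operations on `k` channels over an alphabet of `m` letters: add a letter at the back of a
channel, or read a letter from the front of a channel. -/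
inductive ChannelOp (k m : ℕ) where
  | send (c : Fin k) (a : Fin m)
  | recv (c : Fin k) (a : Fin m)

/-- A functional-lossy channel system with `q` control states, `k` channels and `m` letters is
given by a finite list of transitions (source, operation, target). -/
structure FLCS (q k m : ℕ) where
  transitions : List (Fin q × ChannelOp k m × Fin q)

/-- Configurations: a control state, and one word for each channel. -/
@[ext]
structure Config (q k m : ℕ) where
  control : Fin q
  channels : Fin k → List (Fin m)

namespace Config

variable {q k m : ℕ}

/-- Configurations are ordered by equality of control states, and the (scattered) subword
ordering on each channel. -/
instance : PartialOrder (Config q k m) where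
  le s t := s.control = t.control ∧ ∀ i, (s.channels i).Sublist (t.channels i)
  le_refl _ := ⟨rfl, fun _ => List.Sublist.refl _⟩
  le_trans _ _ _ h h' := ⟨h.1.trans h'.1, fun i => (h.2 i).trans (h'.2 i)⟩
  le_antisymm _ _ h h' := Config.ext h.1 (funext fun i => (h.2 i).antisymm (h'.2 i))

end Config

/-- Functional-lossy reading of `a`: remove all letters up to and including the first `a`. -/
def dropThrough {m : ℕ} (a : Fin m) (w : List (Fin m)) : List (Fin m) :=
  (w.dropWhile (fun b => b ≠ a)).tail

theorem dropThrough_append {m : ℕ} {a : Fin m} {u : List (Fin m)} (h : a ∉ u)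
    (w : List (Fin m)) : dropThrough a (u ++ a :: w) = w := by
  induction u with
  | nil => simp [dropThrough]
  | cons b u ih =>
    simp only [List.mem_cons, not_or] at h
    simpa [dropThrough, Ne.symm h.1] using ih h.2

theorem dropThrough_sublist {m : ℕ} {a : Fin m} {v w : List (Fin m)} (h : v.Sublist w)
    (ha : a ∈ v) : (dropThrough a v).Sublist (dropThrough a w) := by
  obtain ⟨v₁, v₂, rfl, h₁⟩ := List.eq_append_cons_of_mem ha
  obtain ⟨w₁, w₂, rfl, h₂⟩ := List.eq_append_cons_of_mem (h.subset ha)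
  rw [dropThrough_append h₁, dropThrough_append h₂]
  obtain ⟨x, y, hxy, hx, hy⟩ := List.append_sublist_iff.1 h
  rcases List.append_eq_append_iff.1 hxy with ⟨z, rfl, hz⟩ | ⟨z, rfl, rfl⟩
  · rcases z with _ | ⟨b, z⟩
    · rw [List.nil_append] at hz
      subst hz
      exact (List.cons_sublist_cons.1 hy)
    · simp only [List.cons_append, List.cons.injEq] at hz
      rw [hz.2]
      exact ((List.sublist_cons_self a v₂).trans hy).trans (List.sublist_append_right _ _)
  · rcases List.sublist_append_iff.1 hy with ⟨l₁, l₂, hl, hl₁, hl₂⟩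
    rcases l₁ with _ | ⟨b, l₁⟩
    · rw [List.nil_append] at hl
      subst hl
      exact List.cons_sublist_cons.1 hl₂
    · simp only [List.cons_append, List.cons.injEq] at hl
      exact absurd (List.mem_append_right _ (hl₁.subset (by simp [hl.1]))) h₂

namespace ChannelOp

variable {k m : ℕ}

/-- When an operation is enabled: sending always is, and reading `a` requires an `a` in the
channel. -/
def Enabled : ChannelOp k m → (Fin k → List (Fin m)) → Prop
  | send _ _, _ => True
  | recv c a, w => a ∈ w c

/-- The effect of an operation on the channel contents. -/
def apply : ChannelOp k m → (Fin k → List (Fin m)) → Fin k → List (Fin m)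
  | send c a, w => Function.update w c (w c ++ [a])
  | recv c a, w => Function.update w c (dropThrough a (w c))

end ChannelOp

namespace FLCS

variable {q k m : ℕ}

/-- The partial map on configurations of a transition. -/
def transitionMap (t : Fin q × ChannelOp k m × Fin q) : Config q k m →. Config q k m :=
  fun s => ⟨s.control = t.1 ∧ t.2.1.Enabled s.channels,
    fun _ => ⟨t.2.2, t.2.1.apply s.channels⟩⟩

theorem isPartialMonotone_transitionMap (t : Fin q × ChannelOp k m × Fin q) :
    IsPartialMonotone (transitionMap t) := by
  obtain ⟨p, op, p'⟩ := t
  constructor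
  · rintro s s' ⟨h₁, h₂⟩ ⟨h₃, h₄⟩
    refine ⟨h₁.symm.trans h₃, ?_⟩
    cases op with
    | send c a => trivial
    | recv c a => exact (h₂ c).subset h₄
  · rintro s s' _ _ ⟨h₁, h₂⟩ ⟨⟨_, h₄⟩, rfl⟩ ⟨⟨_, _⟩, rfl⟩
    refine ⟨rfl, fun i => ?_⟩
    cases op with
    | send c a =>
      by_cases hi : i = c
      · subst hi
        simpa [transitionMap, ChannelOp.apply] using (h₂ i)
      · simpa [transitionMap, ChannelOp.apply, hi] using (h₂ i)
    | recv c a =>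
      by_cases hi : i = c
      · subst hi
        simpa [transitionMap, ChannelOp.apply] using dropThrough_sublist (h₂ i) h₄
      · simpa [transitionMap, ChannelOp.apply, hi] using (h₂ i)

/-- The ordered functional transition system of a functional-lossy channel system. -/
def toFunctionalTS (M : FLCS q k m) : FunctionalTS (Config q k m) where
  maps := {f | ∃ t ∈ M.transitions, f = transitionMap t}
  finite_maps := by
    refine ((M.transitions.finite_toSet).image transitionMap).subset ?_
    rintro _ ⟨t, ht, rfl⟩
    exact ⟨t, ht, rfl⟩
  monotone_maps := by
    rintro _ ⟨t, -, rfl⟩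
    exact isPartialMonotone_transitionMap t

end FLCS

/-! ### Word-products, and the representation of ideals of configurations -/

/-- Atomic expressions over `m` letters: `Sum.inl a` stands for `a?`, and `Sum.inr A` stands for
`A*`, where `A` is given by its characteristic function. -/
abbrev Atom (m : ℕ) := Fin m ⊕ (Fin m → Bool)

/-- The language of an atomic expression: `a?` is `{ε, a}`, and `A*` is the set of all words over
`A`. -/
def atomLang {m : ℕ} : Atom m → Set (List (Fin m))
  | Sum.inl a => {[], [a]}
  | Sum.inr A => {w | ∀ b ∈ w, A b = true}

/-- The language of a word-product: the concatenation of the languages of its atoms. -/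
def productLang {m : ℕ} : List (Atom m) → Set (List (Fin m))
  | [] => {[]}
  | α :: P => {w | ∃ u ∈ atomLang α, ∃ v ∈ productLang P, w = u ++ v}

theorem nil_mem_atomLang {m : ℕ} (α : Atom m) : [] ∈ atomLang α := by
  cases α <;> simp [atomLang]

theorem atomLang_lower {m : ℕ} {α : Atom m} {v w : List (Fin m)} (h : v.Sublist w)
    (hw : w ∈ atomLang α) : v ∈ atomLang α := by
  cases α with
  | inl a =>
    rcases hw with rfl | rfl
    · simp [atomLang, List.sublist_nil.1 h]
    · rcases List.sublist_singleton.1 h with rfl | rfl <;> simp [atomLang]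
  | inr A => exact fun b hb => hw b (h.subset hb)

theorem atomLang_directed {m : ℕ} {α : Atom m} {v w : List (Fin m)} (hv : v ∈ atomLang α)
    (hw : w ∈ atomLang α) : ∃ u ∈ atomLang α, v.Sublist u ∧ w.Sublist u := by
  cases α with
  | inl a =>
    refine ⟨[a], by simp [atomLang], ?_, ?_⟩
    · rcases hv with rfl | rfl <;> simp
    · rcases hw with rfl | rfl <;> simp
  | inr A =>
    refine ⟨v ++ w, fun b hb => ?_, List.sublist_append_left _ _, List.sublist_append_right _ _⟩
    exact (List.mem_append.1 hb).elim (hv b) (hw b)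

theorem nil_mem_productLang {m : ℕ} (P : List (Atom m)) : [] ∈ productLang P := by
  induction P with
  | nil => rfl
  | cons α P ih => exact ⟨[], nil_mem_atomLang α, [], ih, rfl⟩

theorem productLang_lower {m : ℕ} {P : List (Atom m)} {v w : List (Fin m)} (h : v.Sublist w)
    (hw : w ∈ productLang P) : v ∈ productLang P := by
  induction P generalizing v w with
  | nil =>
    obtain rfl : w = [] := hw
    exact List.sublist_nil.1 h
  | cons α P ih =>
    obtain ⟨u, hu, u', hu', rfl⟩ := hw
    obtain ⟨v₁, v₂, rfl, h₁, h₂⟩ := List.sublist_append_iff.1 h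
    exact ⟨v₁, atomLang_lower h₁ hu, v₂, ih h₂ hu', rfl⟩

theorem productLang_directed {m : ℕ} {P : List (Atom m)} {v w : List (Fin m)}
    (hv : v ∈ productLang P) (hw : w ∈ productLang P) :
    ∃ u ∈ productLang P, v.Sublist u ∧ w.Sublist u := by
  induction P generalizing v w with
  | nil =>
    obtain rfl : v = [] := hv
    exact ⟨w, hw, List.nil_sublist _, List.Sublist.refl _⟩
  | cons α P ih =>
    obtain ⟨v₁, hv₁, v₂, hv₂, rfl⟩ := hv
    obtain ⟨w₁, hw₁, w₂, hw₂, rfl⟩ := hw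
    obtain ⟨u₁, hu₁, h₁, h₁'⟩ := atomLang_directed hv₁ hw₁
    obtain ⟨u₂, hu₂, h₂, h₂'⟩ := ih hv₂ hw₂
    exact ⟨u₁ ++ u₂, ⟨u₁, hu₁, u₂, hu₂, rfl⟩, h₁.append h₂, h₁'.append h₂'⟩

/-- Symbolic states: a control state, and one word-product for each channel. -/
abbrev SymbConfig (q k m : ℕ) := Fin q × (Fin k → List (Atom m))

/-- The ideal of configurations denoted by a symbolic state. -/
def SymbConfig.toIdeal {q k m : ℕ} (σ : SymbConfig q k m) : Order.Ideal (Config q k m) where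
  carrier := {s | s.control = σ.1 ∧ ∀ i, s.channels i ∈ productLang (σ.2 i)}
  lower' := fun _ _ hts hs =>
    ⟨hts.1.trans hs.1, fun i => productLang_lower (hts.2 i) (hs.2 i)⟩
  nonempty' := ⟨⟨σ.1, fun _ => []⟩, rfl, fun _ => nil_mem_productLang _⟩
  directed' := by
    rintro s ⟨hs, hs'⟩ t ⟨ht, ht'⟩
    choose u hu hsu htu using fun i => productLang_directed (hs' i) (ht' i)
    exact ⟨⟨σ.1, u⟩, ⟨rfl, hu⟩, ⟨hs, hsu⟩, ⟨ht, htu⟩⟩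

/-- The representation of ideals of configurations by (natural numbers that encode) symbolic
states. -/
def wordProductRep (q k m : ℕ) : ℕ →. Order.Ideal (Config q k m) :=
  fun e => ((@Encodable.decode (SymbConfig q k m) Primcodable.toEncodable e).map
    SymbConfig.toIdeal : Option _)

end WSTS

/-!
The system that witnesses the theorem simulates a counter machine which cannot test counters for
zero reliably. A counter with value `n` is a channel with content `0ⁿ`; a zero test sends an end
marker and reads it again, and this sets the counter to zero in any case. So a zero test that is
answered wrongly loses at least one unit, and a run that loses nothing is a run of the
deterministic counter machine (`CounterSim.reach_of_lossyStep`, `CounterSim.exists_lossy_of_reach`).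

The counter machine keeps an input `n` in a counter of its own, and runs a search for some `j` with
`g n j = 0`, where `g` is a primitive recursive function that expresses the halting problem. All
registers of the search draw their units from a finite budget, kept in counter `0`, so that the
total number of units is constant. When the budget is exhausted, the machine collects all units,
adds a single one, and restarts. If the search fails, then every budget is exhausted eventually
(there is an unbounded sequence of candidates `j`), and the budget grows beyond any bound
(`reach_large_budget`). If the search succeeds, then with a large enough budget the intended run
halts without a restart; a run that deviates from it loses at least one unit before the next
restart, which gives back only one. So the budget stays bounded, as long as the input is intact
(`LossyInvariant.step`, `exists_bound_of_search_succeeds`). Lost units of the input are never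
regained. Hence the ideal with input `n` and arbitrary budget is contained in an element of the
clover of the state with input `n` if and only if the search for `n` fails
(`unboundedSymb_subset_cover_iff`), and a recursive clover would decide the halting problem. It is
essential here that the input is compared in the target as well: for a fixed system and a fixed
target, the states from which the target belongs to the cover are upward closed in a well order,
so that they form a decidable set.

The completion of every functional-lossy channel system is an effective complete WSTS. Ideal
completions are continuous dcpos, and extensions of partial monotonic maps to ideals are partial
continuous. The ideals of words are the languages of word-products (`exists_productLang_eq`), and
their inclusion ordering is well by Higman's lemma for lists over the finite set of atomic
expressions. A single primitive recursive operation on word-products, `residual`, provides both the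
inclusion test and the effect of reading a letter.
-/

namespace WSTS

/-! ### Ideal completions -/

section IdealCompletion

variable {X : Type*} [PartialOrder X]

/-- The union of a directed family of ideals. -/
def directedUnion (D : Set (Order.Ideal X)) (hD : IsDirSet D) : Order.Ideal X where
  carrier := {x | ∃ C ∈ D, x ∈ C}
  lower' := fun _ _ hba ⟨C, hC, ha⟩ => ⟨C, hC, C.lower hba ha⟩
  nonempty' := by
    obtain ⟨C, hC⟩ := hD.1
    obtain ⟨x, hx⟩ := C.nonempty
    exact ⟨x, C, hC, hx⟩
  directed' := by
    rintro x ⟨C, hC, hx⟩ y ⟨C', hC', hy⟩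
    obtain ⟨E, hE, h, h'⟩ := hD.2 C hC C' hC'
    obtain ⟨z, hz, hxz, hyz⟩ := E.directed x (h hx) y (h' hy)
    exact ⟨z, ⟨E, hE, hz⟩, hxz, hyz⟩

theorem isLUB_directedUnion (D : Set (Order.Ideal X)) (hD : IsDirSet D) :
    IsLUB D (directedUnion D hD) :=
  ⟨fun C hC _ hx => ⟨C, hC, hx⟩, fun _ hE _ ⟨_, hC, hx⟩ => hE hC hx⟩

theorem mem_iff_of_isLUB {D : Set (Order.Ideal X)} (hD : IsDirSet D) {d : Order.Ideal X}
    (hd : IsLUB D d) {x : X} : x ∈ d ↔ ∃ C ∈ D, x ∈ C := by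
  rw [hd.unique (isLUB_directedUnion D hD)]
  rfl

theorem isDcpo_ideal : IsDcpo (Order.Ideal X) :=
  fun D hD => ⟨_, isLUB_directedUnion D hD⟩

/-- The principal ideals below an ideal. -/
def principalsBelow (C : Order.Ideal X) : Set (Order.Ideal X) :=
  Order.Ideal.principal '' (C : Set X)

theorem isDirSet_principalsBelow (C : Order.Ideal X) : IsDirSet (principalsBelow C) := by
  refine ⟨C.nonempty.image _, ?_⟩
  rintro _ ⟨x, hx, rfl⟩ _ ⟨y, hy, rfl⟩
  obtain ⟨z, hz, hxz, hyz⟩ := C.directed x hx y hy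
  exact ⟨_, ⟨z, hz, rfl⟩, Order.Ideal.principal_le_iff.2 hxz, Order.Ideal.principal_le_iff.2 hyz⟩

theorem isLUB_principalsBelow (C : Order.Ideal X) : IsLUB (principalsBelow C) C := by
  constructor
  · rintro _ ⟨x, hx, rfl⟩
    exact Order.Ideal.principal_le_iff.2 hx
  · intro E hE x hx
    exact hE ⟨x, hx, rfl⟩ (Order.Ideal.mem_principal.2 le_rfl)

theorem wayBelow_principal {C : Order.Ideal X} {x : X} (hx : x ∈ C) :
    WayBelow (Order.Ideal.principal x) C := by
  intro D d hD hd hCd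
  obtain ⟨E, hE, h⟩ := (mem_iff_of_isLUB hD hd).1 (hCd hx)
  exact ⟨E, hE, Order.Ideal.principal_le_iff.2 h⟩

theorem isContinuousPoset_ideal : IsContinuousPoset (Order.Ideal X) := by
  intro C
  have key : ∀ E, WayBelow E C → ∃ x ∈ C, E ≤ Order.Ideal.principal x := fun E hE => by
    obtain ⟨_, ⟨x, hx, rfl⟩, h⟩ :=
      hE _ _ (isDirSet_principalsBelow C) (isLUB_principalsBelow C) le_rfl
    exact ⟨x, hx, h⟩
  refine ⟨⟨?_, ?_⟩, ?_, ?_⟩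
  · obtain ⟨x, hx⟩ := C.nonempty
    exact ⟨_, wayBelow_principal hx⟩
  · intro E hE E' hE'
    obtain ⟨x, hx, h⟩ := key E hE
    obtain ⟨y, hy, h'⟩ := key E' hE'
    obtain ⟨z, hz, hxz, hyz⟩ := C.directed x hx y hy
    exact ⟨_, wayBelow_principal hz, h.trans (Order.Ideal.principal_le_iff.2 hxz),
      h'.trans (Order.Ideal.principal_le_iff.2 hyz)⟩
  · intro E hE
    obtain ⟨x, hx, h⟩ := key E hE
    exact h.trans (Order.Ideal.principal_le_iff.2 hx)
  · intro E hE x hx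
    exact hE (wayBelow_principal hx) (Order.Ideal.mem_principal.2 le_rfl)

theorem isPartialContinuous_soberMap (f : X →. X) (hf : IsPartialMonotone f) :
    IsPartialContinuous (soberMap f hf) := by
  refine ⟨⟨(isPartialMonotone_soberMap f hf).1, ?_⟩, ?_⟩
  · rintro D d hD hd ⟨x, hx, hxf⟩
    obtain ⟨E, hE, hxE⟩ := (mem_iff_of_isLUB hD hd).1 hx
    exact ⟨E, hE, x, hxE, hxf⟩
  · intro D d hD hDf hd
    have hdom : d ∈ (soberMap f hf).Dom := by
      obtain ⟨C, hC⟩ := hD.1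
      exact (isPartialMonotone_soberMap f hf).1 (hd.1 hC) (hDf hC)
    refine ⟨_, Part.get_mem hdom, ?_, ?_⟩
    · rintro E ⟨C, hC, hE⟩
      exact (isPartialMonotone_soberMap f hf).2 _ _ _ _ (hd.1 hC) hE (Part.get_mem hdom)
    · rintro E hE y ⟨x, hx, x', hx', hy⟩
      obtain ⟨C, hC, hxC⟩ := (mem_iff_of_isLUB hD hd).1 hx
      have := hE ⟨C, hC, Part.get_mem (hDf hC)⟩
      exact this ⟨x, hxC, x', hx', hy⟩

theorem FunctionalTS.isCompleteWSTS_completion (T : FunctionalTS X)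
    [WellQuasiOrderedLE (Order.Ideal X)] : T.completion.IsCompleteWSTS := by
  refine ⟨⟨isDcpo_ideal, isContinuousPoset_ideal, inferInstance⟩, ?_⟩
  rintro _ ⟨f, rfl⟩
  exact isPartialContinuous_soberMap _ _

/-! ### Clovers of completions -/

namespace FunctionalTS

variable (T : FunctionalTS X)

/-- The elements of `X` that lie below an element reachable from the ideal `C`. -/
def coverOfIdeal (C : Order.Ideal X) : Set X :=
  {x | ∃ y ∈ C, ∃ z, Relation.ReflTransGen T.Step y z ∧ x ≤ z}

theorem mem_coverOfIdeal_of_reachable {C E : Order.Ideal X}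
    (h : Relation.ReflTransGen T.completion.Step C E) {x : X} (hx : x ∈ E) :
    x ∈ T.coverOfIdeal C := by
  induction h generalizing x with
  | refl => exact ⟨x, hx, x, .refl, le_rfl⟩
  | tail _ hs ih =>
    obtain ⟨_, ⟨f, rfl⟩, hf⟩ := hs
    obtain ⟨-, hE⟩ := mem_soberMap.1 hf
    rw [← SetLike.mem_coe, hE] at hx
    obtain ⟨c, hc, c', hc', hxc⟩ := hx
    obtain ⟨y, hy, z, hyz, hcz⟩ := ih hc
    have hm := T.monotone_maps f.1 f.2
    have hd : z ∈ f.1.Dom := hm.1 hcz (Part.dom_iff_mem.2 ⟨c', hc'⟩)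
    exact ⟨y, hy, _, hyz.tail ⟨f.1, f.2, Part.get_mem hd⟩,
      hxc.trans (hm.2 _ _ _ _ hcz hc' (Part.get_mem hd))⟩

theorem reachable_principal {y z : X} (h : Relation.ReflTransGen T.Step y z) :
    Relation.ReflTransGen T.completion.Step (Order.Ideal.principal y)
      (Order.Ideal.principal z) := by
  induction h with
  | refl => exact .refl
  | @tail z z' _ hs ih =>
    obtain ⟨f, hf, hz⟩ := hs
    refine ih.tail ⟨_, ⟨⟨f, hf⟩, rfl⟩, mem_soberMap.2 ⟨⟨z, Order.Ideal.mem_principal.2 le_rfl,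
      Part.dom_iff_mem.2 ⟨_, hz⟩⟩, ?_⟩⟩
    have hm := T.monotone_maps f hf
    ext x
    constructor
    · intro hx
      exact ⟨z, Order.Ideal.mem_principal.2 le_rfl, z', hz, hx⟩
    · rintro ⟨c, hc, c', hc', hx⟩
      exact le_trans hx (hm.2 _ _ _ _ hc hc' hz)

/-- The directed least upper bounds of the cover of an ideal `C`, computed in the completion, are
the ideals that consist of elements of the cover computed in `X`. -/
theorem mem_lubSet_cover_completion {C E : Order.Ideal X} :
    E ∈ lubSet (T.completion.cover C) ↔ (E : Set X) ⊆ T.coverOfIdeal C := by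
  constructor
  · rintro ⟨D, hD, hdir, hlub⟩ x hx
    obtain ⟨J, hJ, hxJ⟩ := (mem_iff_of_isLUB hdir hlub).1 hx
    obtain ⟨s₁, hs₁, s₂, hs₂, hJs⟩ := hD hJ
    obtain ⟨y, hy, h⟩ := T.mem_coverOfIdeal_of_reachable hs₂ (hJs hxJ)
    exact ⟨y, hs₁ hy, h⟩
  · intro h
    refine ⟨_, ?_, isDirSet_principalsBelow E, isLUB_principalsBelow E⟩
    rintro _ ⟨x, hx, rfl⟩
    obtain ⟨y, hy, z, hyz, hxz⟩ := h hx
    exact ⟨_, Order.Ideal.principal_le_iff.2 hy, _, T.reachable_principal hyz,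
      Order.Ideal.principal_le_iff.2 hxz⟩

/-- An ideal is contained in an element of the clover if and only if it is contained in the
cover. -/
theorem exists_le_mem_clover_completion {C E : Order.Ideal X} :
    (∃ J ∈ T.completion.clover C, E ≤ J) ↔ (E : Set X) ⊆ T.coverOfIdeal C := by
  constructor
  · rintro ⟨J, hJ, hEJ⟩
    exact fun x hx => T.mem_lubSet_cover_completion.1 hJ.1 (hEJ hx)
  · intro h
    obtain ⟨J, hEJ, hJ⟩ := zorn_le_nonempty₀ (lubSet (T.completion.cover C))
      (fun D hD hchain y hy => by
        have hdir : IsDirSet D := ⟨⟨y, hy⟩, hchain.directedOn⟩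
        refine ⟨_, ?_, (isLUB_directedUnion D hdir).1⟩
        refine T.mem_lubSet_cover_completion.2 ?_
        rintro x ⟨J, hJ, hx⟩
        exact T.mem_lubSet_cover_completion.1 (hD hJ) hx)
      E (T.mem_lubSet_cover_completion.2 h)
    exact ⟨J, hJ, hEJ⟩

end FunctionalTS

end IdealCompletion

/-! ### Word-products denote exactly the ideals of words -/

section WordProducts

variable {m : ℕ}

theorem cons_mem_productLang_inl {a x : Fin m} {w : List (Fin m)} {P : List (Atom m)} :
    x :: w ∈ productLang (Sum.inl a :: P) ↔
      (x = a ∧ w ∈ productLang P) ∨ x :: w ∈ productLang P := by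
  constructor
  · rintro ⟨u, rfl | rfl, v, hv, h⟩
    · rw [List.nil_append] at h
      exact .inr (h ▸ hv)
    · obtain ⟨rfl, rfl⟩ := List.cons_eq_cons.1 h
      exact .inl ⟨rfl, hv⟩
  · rintro (⟨rfl, h⟩ | h)
    · exact ⟨[x], .inr rfl, w, h, rfl⟩
    · exact ⟨[], .inl rfl, _, h, rfl⟩

theorem cons_mem_productLang_inr {A : Fin m → Bool} {x : Fin m} {w : List (Fin m)}
    {P : List (Atom m)} :
    x :: w ∈ productLang (Sum.inr A :: P) ↔
      (A x = true ∧ w ∈ productLang (Sum.inr A :: P)) ∨ x :: w ∈ productLang P := by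
  constructor
  · rintro ⟨u, hu, v, hv, h⟩
    rcases u with _ | ⟨y, u⟩
    · rw [List.nil_append] at h
      exact .inr (h ▸ hv)
    · obtain ⟨rfl, rfl⟩ := List.cons_eq_cons.1 h
      exact .inl ⟨hu _ (by simp), u, fun b hb => hu b (by simp [hb]), v, hv, rfl⟩
  · rintro (⟨hx, u, hu, v, hv, rfl⟩ | h)
    · exact ⟨x :: u, by simpa [atomLang, hx] using hu, v, hv, rfl⟩
    · exact ⟨[], by simp [atomLang], _, h, rfl⟩

theorem productLang_subset_cons (α : Atom m) (P : List (Atom m)) :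
    productLang P ⊆ productLang (α :: P) :=
  fun w hw => ⟨[], nil_mem_atomLang α, w, hw, rfl⟩

theorem productLang_cons_subset_cons (α : Atom m) {P Q : List (Atom m)}
    (h : productLang P ⊆ productLang Q) : productLang (α :: P) ⊆ productLang (α :: Q) := by
  rintro _ ⟨u, hu, v, hv, rfl⟩
  exact ⟨u, hu, v, h hv, rfl⟩

theorem productLang_subset_of_sublist {P Q : List (Atom m)} (h : P.Sublist Q) :
    productLang P ⊆ productLang Q := by
  induction h with
  | slnil => exact subset_rfl
  | cons α _ ih => exact ih.trans (productLang_subset_cons α _)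
  | cons_cons α _ ih => exact productLang_cons_subset_cons α ih

theorem append_mem_productLang_inr {A : Fin m → Bool} {u v : List (Fin m)} {P : List (Atom m)}
    (hu : ∀ b ∈ u, A b = true) (hv : v ∈ productLang (Sum.inr A :: P)) :
    u ++ v ∈ productLang (Sum.inr A :: P) := by
  induction u with
  | nil => exact hv
  | cons b u ih =>
    exact cons_mem_productLang_inr.2 (.inl ⟨hu b (by simp), ih fun c hc => hu c (by simp [hc])⟩)

/-- The words of a word-product that do not have a given word `w` as a subword form a finite
union of word-products. As languages of word-products are closed under subwords, such a
word-product avoids `w` as soon as `w` is not a member of it. -/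
theorem exists_products_avoiding (w : List (Fin m)) (P : List (Atom m)) :
    ∃ Qs : List (List (Atom m)),
      (∀ Q ∈ Qs, productLang Q ⊆ productLang P ∧ w ∉ productLang Q) ∧
      ∀ x ∈ productLang P, ¬ w.Sublist x → ∃ Q ∈ Qs, x ∈ productLang Q := by
  induction w generalizing P with
  | nil => exact ⟨[], by simp, fun x _ h => absurd (List.nil_sublist x) h⟩
  | cons a w ihw =>
    induction P with
    | nil =>
      refine ⟨[[]], ?_, fun x hx _ => ⟨[], by simp, hx⟩⟩
      simp [productLang]
    | cons α P ihP =>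
      obtain ⟨Rs, hRs, hRs'⟩ := ihP
      rcases α with b | A
      · by_cases hab : a = b
        · subst hab
          obtain ⟨Ts, hTs, hTs'⟩ := ihw P
          refine ⟨Rs ++ Ts.map (Sum.inl a :: ·), ?_, ?_⟩
          · intro Q hQ
            rw [List.mem_append] at hQ
            rcases hQ with hQ | hQ
            · exact ⟨(hRs Q hQ).1.trans (productLang_subset_cons _ _), (hRs Q hQ).2⟩
            · rw [List.mem_map] at hQ
              obtain ⟨Q, hQ, rfl⟩ := hQ
              refine ⟨productLang_cons_subset_cons _ (hTs Q hQ).1, fun h => (hTs Q hQ).2 ?_⟩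
              rcases cons_mem_productLang_inl.1 h with ⟨-, h⟩ | h
              · exact h
              · exact productLang_lower (List.sublist_cons_self _ _) h
          · rintro x ⟨u, rfl | rfl, v, hv, rfl⟩ hx
            · obtain ⟨Q, hQ, h⟩ := hRs' _ hv hx
              exact ⟨Q, by simp [hQ], h⟩
            · obtain ⟨Q, hQ, h⟩ := hTs' _ hv fun h => hx (List.cons_sublist_cons.2 h)
              exact ⟨Sum.inl a :: Q, by simp [hQ], [a], .inr rfl, _, h, rfl⟩
        · refine ⟨Rs.map (Sum.inl b :: ·), ?_, ?_⟩
          · intro Q hQ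
            rw [List.mem_map] at hQ
            obtain ⟨Q, hQ, rfl⟩ := hQ
            refine ⟨productLang_cons_subset_cons _ (hRs Q hQ).1, fun h => (hRs Q hQ).2 ?_⟩
            rcases cons_mem_productLang_inl.1 h with ⟨h, -⟩ | h
            · exact absurd h hab
            · exact h
          · rintro x ⟨u, hu, v, hv, rfl⟩ hx
            obtain ⟨Q, hQ, h⟩ := hRs' v hv fun h => hx (h.trans (List.sublist_append_right _ _))
            exact ⟨Sum.inl b :: Q, by simp [hQ], u, hu, v, h, rfl⟩
      · by_cases hA : A a = true
        · obtain ⟨Ts, hTs, hTs'⟩ := ihw (Sum.inr A :: P)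
          -- The letters before the first `a` range over `A` without `a`.
          set B : Fin m → Bool := fun b => A b && decide (b ≠ a) with hB
          have hBA : ∀ {u : List (Fin m)}, (∀ b ∈ u, B b = true) → ∀ b ∈ u, A b = true := by
            intro u hu b hb
            have := hu b hb
            simp only [hB, Bool.and_eq_true] at this
            exact this.1
          have hBu : ∀ {u : List (Fin m)}, (∀ b ∈ u, A b = true) → a ∉ u → ∀ b ∈ u, B b = true := by
            intro u hu ha b hb
            simp only [hB, Bool.and_eq_true, decide_eq_true_eq]
            exact ⟨hu b hb, fun h => ha (h ▸ hb)⟩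
          have hBa : ¬ B a = true := by simp [hB]
          refine ⟨Rs.map (Sum.inr B :: ·) ++ Ts.map (Sum.inr B :: Sum.inl a :: ·), ?_, ?_⟩
          · intro Q hQ
            rw [List.mem_append] at hQ
            rcases hQ with hQ | hQ
            · rw [List.mem_map] at hQ
              obtain ⟨Q, hQ, rfl⟩ := hQ
              refine ⟨?_, fun h => (hRs Q hQ).2 ?_⟩
              · rintro _ ⟨u, hu, v, hv, rfl⟩
                exact ⟨u, hBA hu, v, (hRs Q hQ).1 hv, rfl⟩
              · rcases cons_mem_productLang_inr.1 h with ⟨h, -⟩ | h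
                · exact absurd h hBa
                · exact h
            · rw [List.mem_map] at hQ
              obtain ⟨Q, hQ, rfl⟩ := hQ
              refine ⟨?_, fun h => (hTs Q hQ).2 ?_⟩
              · rintro _ ⟨u, hu, _, ⟨t, rfl | rfl, v, hv, rfl⟩, rfl⟩
                · exact append_mem_productLang_inr (hBA hu) ((hTs Q hQ).1 hv)
                · exact append_mem_productLang_inr (hBA hu)
                    (cons_mem_productLang_inr.2 (.inl ⟨hA, (hTs Q hQ).1 hv⟩))
              · rcases cons_mem_productLang_inr.1 h with ⟨h, -⟩ | h
                · exact absurd h hBa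
                · rcases cons_mem_productLang_inl.1 h with ⟨-, h⟩ | h
                  · exact h
                  · exact productLang_lower (List.sublist_cons_self _ _) h
          · rintro x ⟨u, hu, v, hv, rfl⟩ hx
            by_cases ha : a ∈ u
            · obtain ⟨u₁, u₂, rfl, h₁⟩ := List.eq_append_cons_of_mem ha
              obtain ⟨Q, hQ, h⟩ := hTs' (u₂ ++ v)
                ⟨u₂, fun b hb => hu b (by simp [hb]), v, hv, rfl⟩ (fun h => hx (by
                  rw [List.append_assoc]
                  exact (List.cons_sublist_cons.2 h).trans (List.sublist_append_right _ _)))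
              refine ⟨Sum.inr B :: Sum.inl a :: Q, by simp [hQ], u₁,
                hBu (fun b hb => hu b (by simp [hb])) h₁, a :: (u₂ ++ v),
                ⟨[a], .inr rfl, _, h, rfl⟩, by simp⟩
            · obtain ⟨Q, hQ, h⟩ := hRs' v hv fun h => hx (h.trans (List.sublist_append_right _ _))
              exact ⟨Sum.inr B :: Q, by simp [hQ], u, hBu hu ha, v, h, rfl⟩
        · refine ⟨Rs.map (Sum.inr A :: ·), ?_, ?_⟩
          · intro Q hQ
            rw [List.mem_map] at hQ
            obtain ⟨Q, hQ, rfl⟩ := hQ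
            refine ⟨productLang_cons_subset_cons _ (hRs Q hQ).1, fun h => (hRs Q hQ).2 ?_⟩
            rcases cons_mem_productLang_inr.1 h with ⟨h, -⟩ | h
            · exact absurd h hA
            · exact h
          · rintro x ⟨u, hu, v, hv, rfl⟩ hx
            obtain ⟨Q, hQ, h⟩ := hRs' v hv fun h => hx (h.trans (List.sublist_append_right _ _))
            exact ⟨Sum.inr A :: Q, by simp [hQ], u, hu, v, h, rfl⟩

/-- Higman's lemma for lists of atomic expressions. -/
theorem wellQuasiOrdered_sublist_atoms (m : ℕ) :
    WellQuasiOrdered (List.Sublist : List (Atom m) → List (Atom m) → Prop) := by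
  have h := Set.PartiallyWellOrderedOn.partiallyWellOrderedOn_sublistForall₂
    (α := Atom m) (· = ·) (s := Set.univ)
    (Set.partiallyWellOrderedOn_of_wellQuasiOrdered (Finite.wellQuasiOrdered _) _)
  intro f
  obtain ⟨i, j, hij, hs⟩ := Set.PartiallyWellOrderedOn.exists_lt h (f := f) (by simp)
  refine ⟨i, j, hij, ?_⟩
  obtain ⟨l, hl, hl'⟩ := List.sublistForall₂_iff.1 hs
  rw [List.forall₂_eq_eq_eq] at hl
  exact hl ▸ hl'

theorem wellFounded_productLang_ssubset (m : ℕ) :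
    WellFounded fun P Q : List (Atom m) => productLang P ⊂ productLang Q := by
  have h : WellQuasiOrdered fun P Q : List (Atom m) => productLang P ⊆ productLang Q := fun f => by
    obtain ⟨i, j, hij, hs⟩ := wellQuasiOrdered_sublist_atoms m f
    exact ⟨i, j, hij, productLang_subset_of_sublist hs⟩
  have : IsPreorder (List (Atom m)) fun P Q => productLang P ⊆ productLang Q :=
    { refl := fun _ => subset_rfl
      trans := fun _ _ _ => Set.Subset.trans }
  exact h.wellFounded

/-- A directed set of words that is covered by finitely many word-products is contained in one of
them. -/
theorem exists_subset_of_directed {I : Set (List (Fin m))} (hne : I.Nonempty)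
    (hdir : ∀ v ∈ I, ∀ w ∈ I, ∃ u ∈ I, v.Sublist u ∧ w.Sublist u) (Qs : List (List (Atom m)))
    (h : ∀ x ∈ I, ∃ Q ∈ Qs, x ∈ productLang Q) : ∃ Q ∈ Qs, I ⊆ productLang Q := by
  by_contra! hc
  have key : ∀ Rs : List (List (Atom m)), Rs ⊆ Qs → ∃ x ∈ I, ∀ Q ∈ Rs, x ∉ productLang Q := by
    intro Rs
    induction Rs with
    | nil => exact fun _ => ⟨hne.some, hne.some_mem, by simp⟩
    | cons Q Rs ih =>
      intro hR
      obtain ⟨hQ, hR⟩ := List.cons_subset.1 hR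
      obtain ⟨x, hx, hxR⟩ := ih hR
      obtain ⟨y, hy, hyQ⟩ := Set.not_subset.1 (hc Q hQ)
      obtain ⟨z, hz, hxz, hyz⟩ := hdir x hx y hy
      refine ⟨z, hz, fun Q' hQ' hzQ => ?_⟩
      rcases List.mem_cons.1 hQ' with rfl | hQ'
      · exact hyQ (productLang_lower hyz hzQ)
      · exact hxR Q' hQ' (productLang_lower hxz hzQ)
  obtain ⟨x, hx, hxQ⟩ := key Qs (List.Subset.refl _)
  obtain ⟨Q, hQ, h⟩ := h x hx
  exact hxQ Q hQ h

/-- Every ideal of words is the language of a word-product: a minimal word-product that contains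
the ideal is equal to it, since a word `w` outside the ideal could be removed. -/
theorem exists_productLang_eq {I : Set (List (Fin m))} (hne : I.Nonempty)
    (hlow : ∀ v w : List (Fin m), v.Sublist w → w ∈ I → v ∈ I)
    (hdir : ∀ v ∈ I, ∀ w ∈ I, ∃ u ∈ I, v.Sublist u ∧ w.Sublist u) :
    ∃ P, productLang P = I := by
  obtain ⟨P, hP, hmin⟩ := (wellFounded_productLang_ssubset m).has_min {P | I ⊆ productLang P}
    ⟨[Sum.inr fun _ => true], fun w _ => ⟨w, by simp [atomLang], [], rfl, by simp⟩⟩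
  refine ⟨P, subset_antisymm (fun w hw => ?_) hP⟩
  by_contra hwI
  obtain ⟨Qs, hQs, hcov⟩ := exists_products_avoiding w P
  obtain ⟨Q, hQ, hIQ⟩ := exists_subset_of_directed hne hdir Qs fun x hx =>
    hcov x (hP hx) fun h => hwI (hlow w x h hx)
  exact hmin Q hIQ ⟨(hQs Q hQ).1, fun h => (hQs Q hQ).2 (h hw)⟩

end WordProducts

/-! ### Symbolic states denote exactly the ideals of configurations -/

section SymbolicStates

variable {q k m : ℕ}

/-- Every ideal of configurations is denoted by a symbolic state: it is the product of its
projections to the channels, for the control state that all its elements share. -/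
theorem SymbConfig.toIdeal_surjective :
    Function.Surjective (SymbConfig.toIdeal : SymbConfig q k m → _) := by
  intro I
  have hproj : ∀ i : Fin k, ∃ P : List (Atom m),
      productLang P = (fun s => s.channels i) '' (I : Set (Config q k m)) := by
    intro i
    refine exists_productLang_eq (I.nonempty.image _) ?_ ?_
    · rintro v _ hvw ⟨s, hs, rfl⟩
      refine ⟨⟨s.control, Function.update s.channels i v⟩,
        I.lower (show _ ≤ s from ⟨rfl, fun j => ?_⟩) hs, by simp⟩
      by_cases hj : j = i
      · subst hj
        simpa using hvw
      · simp [hj]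
    · rintro _ ⟨s, hs, rfl⟩ _ ⟨t, ht, rfl⟩
      obtain ⟨u, hu, hsu, htu⟩ := I.directed s hs t ht
      exact ⟨_, ⟨u, hu, rfl⟩, hsu.2 i, htu.2 i⟩
  choose P hP using hproj
  obtain ⟨s₀, hs₀⟩ := I.nonempty
  have hctrl : ∀ s ∈ I, s.control = s₀.control := fun s hs => by
    obtain ⟨u, _, hsu, h0u⟩ := I.directed s hs s₀ hs₀
    exact hsu.1.trans h0u.1.symm
  refine ⟨(s₀.control, P), Order.Ideal.ext (Set.ext fun s =>
    ⟨?_, fun hs => ⟨hctrl s hs, fun i => ?_⟩⟩)⟩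
  · rintro ⟨hs, hs'⟩
    -- Finitely many elements of the ideal, one for each channel, have a common upper bound.
    have hex : ∀ i, ∃ t ∈ I, s.channels i = t.channels i := fun i => by
      have := hs' i
      rw [hP] at this
      obtain ⟨t, ht, h⟩ := this
      exact ⟨t, ht, h.symm⟩
    choose t ht hst using hex
    have hub : ∀ F : Finset (Fin k), ∃ u ∈ I, ∀ i ∈ F, t i ≤ u := by
      intro F
      induction F using Finset.induction_on with
      | empty => exact ⟨s₀, hs₀, by simp⟩
      | insert i F _ ih =>
        obtain ⟨u, hu, h⟩ := ih
        obtain ⟨z, hz, huz, htz⟩ := I.directed u hu (t i) (ht i)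
        refine ⟨z, hz, fun j hj => ?_⟩
        rcases Finset.mem_insert.1 hj with rfl | hj
        · exact htz
        · exact (h j hj).trans huz
    obtain ⟨u, hu, h⟩ := hub Finset.univ
    refine I.lower ⟨hs.trans (hctrl u hu).symm, fun i => ?_⟩ hu
    rw [hst i]
    exact (h i (Finset.mem_univ i)).2 i
  · rw [hP]
    exact ⟨s, hs, rfl⟩

instance wellQuasiOrderedLE_ideal_config : WellQuasiOrderedLE (Order.Ideal (Config q k m)) := by
  have : IsPreorder (List (Atom m)) List.Sublist :=
    { refl := List.Sublist.refl
      trans := fun _ _ _ => List.Sublist.trans }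
  have hpi := WellQuasiOrdered.pi (ι := Fin k) (r := fun _ => List.Sublist)
    fun _ => wellQuasiOrdered_sublist_atoms m
  have hprod := WellQuasiOrdered.prod (Finite.wellQuasiOrdered (α := Fin q) (· = ·)) hpi
  refine ⟨hprod.of_surjective ⟨SymbConfig.toIdeal, ?_⟩ SymbConfig.toIdeal_surjective⟩
  rintro σ τ ⟨h₁, h₂⟩ s ⟨hs, hs'⟩
  exact ⟨hs.trans h₁, fun i => productLang_subset_of_sublist (h₂ i) (hs' i)⟩

end SymbolicStates

/-! ### Algorithms on word-products -/

section Algorithms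

variable {m : ℕ}

/-- Whether the atomic expression `α` can be matched by the atomic expression `β`. -/
def atomAbsorbs : Atom m → Atom m → Bool
  | Sum.inl a, Sum.inl b => decide (a = b)
  | Sum.inl a, Sum.inr B => B a
  | Sum.inr _, Sum.inl _ => false
  | Sum.inr A, Sum.inr B => decide (∀ x, A x = true → B x = true)

/-- Whether an atomic expression is `∅*`, with language `{ε}`. -/
def isEmptyStar : Atom m → Bool
  | Sum.inl _ => false
  | Sum.inr A => decide (∀ x, A x = false)

/-- What remains of a word-product after its first atomic expression that absorbs `α` has been
used: an expression `b?` is used up, and an expression `B*` is kept. -/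
def residual (α : Atom m) : List (Atom m) → Option (List (Atom m))
  | [] => none
  | β :: Q => if atomAbsorbs α β then some (if β.isLeft then Q else β :: Q) else residual α Q

/-- Inclusion test for word-products. The atomic expressions of the first word-product are matched
greedily; `∅*` is skipped, since it is included in every word-product. -/
def productIncl : List (Atom m) → List (Atom m) → Bool
  | [], _ => true
  | α :: P, Q =>
    if isEmptyStar α then productIncl P Q else ((residual α Q).map (productIncl P)).getD false

/-- The residual for `a?` computes the left quotient by the letter `a`. -/
theorem cons_mem_productLang_iff_residual {a : Fin m} {w : List (Fin m)} {Q : List (Atom m)} :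
    a :: w ∈ productLang Q ↔ ∃ Q', residual (Sum.inl a) Q = some Q' ∧ w ∈ productLang Q' := by
  induction Q with
  | nil => simp [productLang, residual]
  | cons β Q ih =>
    rcases β with b | B
    · rw [cons_mem_productLang_inl, ih]
      by_cases hab : a = b
      · simp only [residual, atomAbsorbs, hab, decide_true, if_true, Sum.isLeft_inl,
          Option.some.injEq, exists_eq_left', true_and, or_iff_left_iff_imp]
        rw [← hab, ← ih]
        exact productLang_lower (List.sublist_cons_self _ _)
      · simp [residual, atomAbsorbs, hab]
    · rw [cons_mem_productLang_inr, ih]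
      by_cases hB : B a = true
      · simp only [residual, atomAbsorbs, hB, if_true, Sum.isLeft_inr, Option.some.injEq,
          exists_eq_left', true_and, or_iff_left_iff_imp, Bool.false_eq_true, if_false]
        rw [← ih]
        exact fun h =>
          productLang_subset_cons _ _ (productLang_lower (List.sublist_cons_self _ _) h)
      · simp [residual, atomAbsorbs, hB]

theorem productLang_inl_subset_iff {a : Fin m} {P Q : List (Atom m)} :
    productLang (Sum.inl a :: P) ⊆ productLang Q ↔
      ∃ Q', residual (Sum.inl a) Q = some Q' ∧ productLang P ⊆ productLang Q' := by
  constructor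
  · intro h
    have h' : ∀ w ∈ productLang P, a :: w ∈ productLang Q := fun w hw =>
      h (cons_mem_productLang_inl.2 (.inl ⟨rfl, hw⟩))
    obtain ⟨Q', hQ', -⟩ := cons_mem_productLang_iff_residual.1 (h' [] (nil_mem_productLang P))
    refine ⟨Q', hQ', fun w hw => ?_⟩
    obtain ⟨Q'', hQ'', hwQ⟩ := cons_mem_productLang_iff_residual.1 (h' w hw)
    rw [hQ'] at hQ''
    obtain rfl := Option.some.inj hQ''
    exact hwQ
  · rintro ⟨Q', hQ', h⟩ _ ⟨u, rfl | rfl, v, hv, rfl⟩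
    · exact productLang_lower (List.sublist_cons_self a _)
        (cons_mem_productLang_iff_residual.2 ⟨Q', hQ', h hv⟩)
    · exact cons_mem_productLang_iff_residual.2 ⟨Q', hQ', h hv⟩

/-- The condition `A a = true` excludes `∅*`, whose language is included even if no atomic
expression absorbs it. -/
theorem productLang_inr_subset_iff {A : Fin m → Bool} {P : List (Atom m)} {a : Fin m}
    (ha : A a = true) {Q : List (Atom m)} :
    productLang (Sum.inr A :: P) ⊆ productLang Q ↔
      ∃ Q', residual (Sum.inr A) Q = some Q' ∧ productLang P ⊆ productLang Q' := by
  have hcons : ∀ {b : Fin m} {w : List (Fin m)}, A b = true → w ∈ productLang (Sum.inr A :: P) →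
      b :: w ∈ productLang (Sum.inr A :: P) := fun hb hw =>
    cons_mem_productLang_inr.2 (.inl ⟨hb, hw⟩)
  induction Q with
  | nil =>
    simp only [residual, reduceCtorEq, false_and, exists_false, iff_false]
    intro h
    exact absurd (h (hcons ha (nil_mem_productLang _))) (List.cons_ne_nil _ _)
  | cons β Q ih =>
    rcases β with b | B
    · simp only [residual, atomAbsorbs, Bool.false_eq_true, if_false]
      refine Iff.trans ⟨fun h w hw => ?_, fun h => h.trans (productLang_subset_cons _ _)⟩ ih
      -- With two additional letters, one of them is matched by `Q`.
      rcases cons_mem_productLang_inl.1 (h (hcons ha (hcons ha hw))) with ⟨-, h⟩ | h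
      · exact productLang_lower (List.sublist_cons_self _ _) h
      · exact productLang_lower
          ((List.sublist_cons_self a w).trans (List.sublist_cons_self a _)) h
    · by_cases hAB : ∀ x, A x = true → B x = true
      · have hres : residual (Sum.inr A) (Sum.inr B :: Q) = some (Sum.inr B :: Q) := by
          simp only [residual, atomAbsorbs, decide_eq_true hAB, if_true, Sum.isLeft_inr,
            Bool.false_eq_true, if_false]
        simp only [hres, Option.some.injEq, exists_eq_left']
        refine ⟨fun h => (productLang_subset_cons _ _).trans h, fun h => ?_⟩
        rintro _ ⟨u, hu, v, hv, rfl⟩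
        exact append_mem_productLang_inr (fun b hb => hAB b (hu b hb)) (h hv)
      · simp only [residual, atomAbsorbs, hAB, decide_false, Bool.false_eq_true, if_false]
        refine Iff.trans ⟨fun h w hw => ?_, fun h => h.trans (productLang_subset_cons _ _)⟩ ih
        push Not at hAB
        obtain ⟨b, hb, hbB⟩ := hAB
        rcases cons_mem_productLang_inr.1 (h (hcons hb hw)) with ⟨h, -⟩ | h
        · exact absurd h hbB
        · exact productLang_lower (List.sublist_cons_self _ _) h

theorem productIncl_iff {P Q : List (Atom m)} :
    productIncl P Q = true ↔ productLang P ⊆ productLang Q := by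
  induction P generalizing Q with
  | nil =>
    simp only [productIncl, true_iff]
    rintro w rfl
    exact nil_mem_productLang Q
  | cons α P ih =>
    have key : ∀ R : Option (List (Atom m)), (R.map (productIncl P)).getD false = true ↔
        ∃ Q', R = some Q' ∧ productLang P ⊆ productLang Q' := by
      rintro (_ | R) <;> simp [ih]
    rcases α with a | A
    · rw [productLang_inl_subset_iff, ← key]
      simp [productIncl, isEmptyStar]
    · by_cases hA : ∀ x, A x = false
      · simp only [productIncl, isEmptyStar, hA, implies_true, decide_true, if_true, ih]
        have : productLang (Sum.inr A :: P) = productLang P := by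
          refine subset_antisymm ?_ (productLang_subset_cons _ _)
          rintro _ ⟨u, hu, v, hv, rfl⟩
          rcases u with _ | ⟨b, u⟩
          · exact hv
          · have := hu b (by simp)
            simp [hA] at this
        rw [this]
      · have hA' := hA
        push Not at hA'
        obtain ⟨a, ha⟩ := hA'
        rw [productLang_inr_subset_iff (a := a) (by simpa using ha), ← key]
        simp [productIncl, isEmptyStar, hA]

theorem primrec_residual : Primrec₂ (residual : Atom m → _) := by
  have habs : Primrec₂ (atomAbsorbs : Atom m → Atom m → Bool) :=
    Primrec.dom_finite fun p : Atom m × Atom m => atomAbsorbs p.1 p.2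
  have hleft : Primrec (Sum.isLeft : Atom m → Bool) := Primrec.dom_finite _
  refine (Primrec.list_rec (f := fun p : Atom m × List (Atom m) => p.2) (g := fun _ => none)
    (h := fun p x => if atomAbsorbs p.1 x.1 then
      some (if x.1.isLeft then x.2.1 else x.1 :: x.2.1) else x.2.2)
    Primrec.snd (Primrec.const none) ?_).of_eq ?_
  · have hx : Primrec fun y : (Atom m × List (Atom m)) ×
        (Atom m × List (Atom m) × Option (List (Atom m))) => y.2.1 :=
      Primrec.fst.comp Primrec.snd
    have hQ : Primrec fun y : (Atom m × List (Atom m)) ×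
        (Atom m × List (Atom m) × Option (List (Atom m))) => y.2.2.1 :=
      Primrec.fst.comp (Primrec.snd.comp Primrec.snd)
    refine Primrec.ite (Primrec.eq.comp (habs.comp (Primrec.fst.comp Primrec.fst) hx)
      (Primrec.const true)) (Primrec.option_some.comp ?_)
      (Primrec.snd.comp (Primrec.snd.comp Primrec.snd))
    exact Primrec.ite (Primrec.eq.comp (hleft.comp hx) (Primrec.const true)) hQ
      (Primrec.list_cons.comp hx hQ)
  · rintro ⟨α, Q⟩
    induction Q with
    | nil => rfl
    | cons β Q ih =>
      simp only [residual] at ih ⊢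
      rw [← ih]

theorem primrec_productIncl : Primrec₂ (productIncl : List (Atom m) → _) := by
  have hempty : Primrec (isEmptyStar : Atom m → Bool) := Primrec.dom_finite _
  have hfold : ∀ (P : List (Atom m)) (R : Option (List (Atom m))),
      (P.foldl (fun R α => if isEmptyStar α then R else R.bind (residual α)) R).isSome =
        (R.map (productIncl P)).getD false := by
    intro P
    induction P with
    | nil => rintro (_ | R) <;> simp [productIncl]
    | cons α P ih =>
      intro R
      rw [List.foldl_cons, ih]
      rcases R with _ | R
      · simp
      · by_cases h : isEmptyStar α = true <;> simp [productIncl, h]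
  have := Primrec.list_foldl
    (f := fun p : List (Atom m) × List (Atom m) => p.1) (g := fun p => some p.2)
    (h := fun _ x => if isEmptyStar x.2 then x.1 else x.1.bind (residual x.2))
    Primrec.fst (Primrec.option_some.comp Primrec.snd) (by
      refine Primrec.ite (Primrec.eq.comp (hempty.comp (Primrec.snd.comp Primrec.snd))
        (Primrec.const true)) (Primrec.fst.comp Primrec.snd) ?_
      exact Primrec.option_bind (Primrec.fst.comp Primrec.snd)
        (primrec_residual.comp (Primrec.snd.comp (Primrec.snd.comp Primrec.fst)) Primrec.snd))
  exact (Primrec.option_isSome.comp this).of_eq fun p => by simpa using hfold p.1 (some p.2)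

end Algorithms

/-! ### Effectivity of completions of functional-lossy channel systems -/

section Effective

variable {q k m : ℕ}

theorem SymbConfig.toIdeal_le_iff {σ τ : SymbConfig q k m} :
    σ.toIdeal ≤ τ.toIdeal ↔ σ.1 = τ.1 ∧ ∀ i, productLang (σ.2 i) ⊆ productLang (τ.2 i) := by
  constructor
  · intro h
    have h' : ∀ s : Config q k m, s ∈ σ.toIdeal → s ∈ τ.toIdeal := fun s hs => h hs
    refine ⟨(h' ⟨σ.1, fun _ => []⟩ ⟨rfl, fun _ => nil_mem_productLang _⟩).1, fun i w hw => ?_⟩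
    have := (h' ⟨σ.1, Function.update (fun _ => []) i w⟩ ⟨rfl, fun j => ?_⟩).2 i
    · simpa using this
    · by_cases hj : j = i
      · subst hj
        simpa using hw
      · simpa [hj] using nil_mem_productLang _
  · rintro ⟨h₁, h₂⟩ s ⟨hs, hs'⟩
    exact ⟨hs.trans h₁, fun i => h₂ i (hs' i)⟩

/-- Inclusion test for symbolic states. -/
def symbIncl (σ τ : SymbConfig q k m) : Bool :=
  decide (σ.1 = τ.1) && (List.ofFn fun i => productIncl (σ.2 i) (τ.2 i)).foldr (· && ·) true

theorem symbIncl_iff {σ τ : SymbConfig q k m} :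
    symbIncl σ τ = true ↔ σ.toIdeal ≤ τ.toIdeal := by
  have hall : ∀ l : List Bool, l.foldr (· && ·) true = true ↔ ∀ b ∈ l, b = true := by
    intro l
    induction l with
    | nil => simp
    | cons b l ih => simp [ih]
  simp only [symbIncl, Bool.and_eq_true, decide_eq_true_eq, hall, SymbConfig.toIdeal_le_iff,
    ← productIncl_iff, List.forall_mem_ofFn_iff]

theorem primrec_symbIncl : Primrec₂ (symbIncl : SymbConfig q k m → _) := by
  have hch : ∀ i : Fin k, Primrec fun σ : SymbConfig q k m => σ.2 i := fun i =>
    Primrec.fin_app.comp Primrec.snd (Primrec.const i)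
  have hand : Primrec₂ (· && · : Bool → Bool → Bool) := Primrec.and
  refine Primrec.and.comp (Primrec.eq.decide.comp (Primrec.fst.comp Primrec.fst)
    (Primrec.fst.comp Primrec.snd)) ?_
  exact Primrec.list_foldr (f := fun p : SymbConfig q k m × SymbConfig q k m =>
      List.ofFn fun i => productIncl (p.1.2 i) (p.2.2 i)) (g := fun _ => true)
    (h := fun _ x => x.1 && x.2)
    (Primrec.list_ofFn fun i => primrec_productIncl.comp ((hch i).comp Primrec.fst)
      ((hch i).comp Primrec.snd))
    (Primrec.const true)
    (hand.comp (Primrec.fst.comp Primrec.snd) (Primrec.snd.comp Primrec.snd))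

/-- The effect of a transition on symbolic states. -/
def symbStep (t : Fin q × ChannelOp k m × Fin q) (σ : SymbConfig q k m) :
    Option (SymbConfig q k m) :=
  if σ.1 = t.1 then
    match t.2.1 with
    | .send c a => some (t.2.2, Function.update σ.2 c (σ.2 c ++ [Sum.inl a]))
    | .recv c a =>
      (residual (Sum.inl a) (σ.2 c)).map fun Q => (t.2.2, Function.update σ.2 c Q)
  else none

theorem productLang_append {P Q : List (Atom m)} {w : List (Fin m)} :
    w ∈ productLang (P ++ Q) ↔ ∃ u ∈ productLang P, ∃ v ∈ productLang Q, w = u ++ v := by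
  induction P generalizing w with
  | nil => simp [productLang]
  | cons α P ih =>
    constructor
    · rintro ⟨x, hx, y, hy, rfl⟩
      obtain ⟨u, hu, v, hv, rfl⟩ := ih.1 hy
      exact ⟨x ++ u, ⟨x, hx, u, hu, rfl⟩, v, hv, by simp⟩
    · rintro ⟨_, ⟨x, hx, u, hu, rfl⟩, v, hv, rfl⟩
      exact ⟨x, hx, u ++ v, ih.2 ⟨u, hu, v, hv, rfl⟩, by simp⟩

theorem mem_productLang_append_singleton {P : List (Atom m)} {a : Fin m} {w : List (Fin m)} :
    w ∈ productLang (P ++ [Sum.inl a]) ↔ ∃ u ∈ productLang P, w.Sublist (u ++ [a]) := by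
  rw [productLang_append]
  constructor
  · rintro ⟨u, hu, v, ⟨x, hx, y, rfl, rfl⟩, rfl⟩
    refine ⟨u, hu, (List.Sublist.refl u).append ?_⟩
    rcases hx with rfl | rfl <;> simp
  · rintro ⟨u, hu, h⟩
    obtain ⟨v, z, rfl, hv, hz⟩ := List.sublist_append_iff.1 h
    refine ⟨v, productLang_lower hv hu, z, ⟨z, ?_, [], rfl, by simp⟩, rfl⟩
    rcases List.sublist_singleton.1 hz with rfl | rfl <;> simp [atomLang]

theorem residual_eq_none {a : Fin m} {Q : List (Atom m)} (h : residual (Sum.inl a) Q = none)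
    {w : List (Fin m)} (hw : w ∈ productLang Q) : a ∉ w := by
  intro ha
  obtain ⟨u, v, rfl, -⟩ := List.eq_append_cons_of_mem ha
  obtain ⟨Q', hQ', -⟩ := cons_mem_productLang_iff_residual.1
    (productLang_lower (List.sublist_append_right u (a :: v)) hw)
  simp [h] at hQ'

/-- The language of the residual for `a?` consists of the subwords of the words that are left
after reading `a` in words of the given language. -/
theorem mem_productLang_residual {a : Fin m} {Q Q' : List (Atom m)}
    (h : residual (Sum.inl a) Q = some Q') {w : List (Fin m)} :
    w ∈ productLang Q' ↔ ∃ x ∈ productLang Q, a ∈ x ∧ w.Sublist (dropThrough a x) := by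
  have hiff : ∀ v, a :: v ∈ productLang Q ↔ v ∈ productLang Q' := fun v => by
    rw [cons_mem_productLang_iff_residual, h]
    simp
  constructor
  · intro hw
    refine ⟨a :: w, (hiff w).2 hw, by simp, ?_⟩
    rw [← List.nil_append (a :: w), dropThrough_append (by simp)]
  · rintro ⟨x, hx, ha, hwx⟩
    obtain ⟨u, v, rfl, hu⟩ := List.eq_append_cons_of_mem ha
    rw [dropThrough_append hu] at hwx
    exact productLang_lower hwx ((hiff v).1 (productLang_lower (List.sublist_append_right _ _) hx))

theorem symbStep_eq_none {t : Fin q × ChannelOp k m × Fin q} {σ : SymbConfig q k m}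
    (h : symbStep t σ = none) :
    σ.toIdeal ∉ (soberMap (FLCS.transitionMap t) (FLCS.isPartialMonotone_transitionMap t)).Dom := by
  rintro ⟨s, ⟨hs, hs'⟩, ht, hen⟩
  obtain ⟨p, op, p'⟩ := t
  have hp : σ.1 = p := hs.symm.trans ht
  cases op with
  | send c a => simp [symbStep, hp] at h
  | recv c a =>
    simp only [symbStep, hp, if_true, Option.map_eq_none_iff] at h
    exact residual_eq_none h (hs' c) hen

theorem symbStep_eq_some {t : Fin q × ChannelOp k m × Fin q} {σ τ : SymbConfig q k m}
    (h : symbStep t σ = some τ) :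
    τ.toIdeal ∈
      soberMap (FLCS.transitionMap t) (FLCS.isPartialMonotone_transitionMap t) σ.toIdeal := by
  obtain ⟨p, op, p'⟩ := t
  have hp : σ.1 = p := by
    by_contra hp
    simp [symbStep, hp] at h
  -- It suffices to compare the operation and its symbolic version on the channel `c`.
  have key : ∀ (c : Fin k) (Q : List (Atom m)) (en : List (Fin m) → Prop)
      (f : List (Fin m) → List (Fin m)),
      (∀ w : Fin k → List (Fin m), op.Enabled w ↔ en (w c)) →
      (∀ w : Fin k → List (Fin m), op.apply w = Function.update w c (f (w c))) →
      τ = (p', Function.update σ.2 c Q) →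
      (∀ w, w ∈ productLang Q ↔ ∃ x ∈ productLang (σ.2 c), en x ∧ w.Sublist (f x)) →
      τ.toIdeal ∈ soberMap (FLCS.transitionMap (p, op, p'))
        (FLCS.isPartialMonotone_transitionMap (p, op, p')) σ.toIdeal := by
    intro c Q en f hen hf hτ hQ
    subst hτ
    rw [mem_soberMap]
    constructor
    · obtain ⟨x, hx, hex, -⟩ := (hQ []).1 (nil_mem_productLang Q)
      refine ⟨⟨p, Function.update (fun _ => []) c x⟩, ⟨hp.symm, fun i => ?_⟩, rfl, ?_⟩
      · by_cases hi : i = c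
        · subst hi
          simpa using hx
        · simpa [hi] using nil_mem_productLang _
      · exact (hen _).2 (by simpa using hex)
    · ext s
      constructor
      · rintro ⟨hs, hs'⟩
        have hc := hs' c
        simp only [Function.update_self] at hc
        obtain ⟨x, hx, hex, hsub⟩ := (hQ _).1 hc
        have hmem : (⟨p, Function.update s.channels c x⟩ : Config q k m) ∈ σ.toIdeal := by
          refine ⟨hp.symm, fun i => ?_⟩
          by_cases hi : i = c
          · subst hi
            simpa using hx
          · have := hs' i
            simp only [Function.update_of_ne hi] at this
            simpa [hi] using this
        refine ⟨_, hmem, _, ⟨⟨rfl, (hen _).2 (by simpa using hex)⟩, rfl⟩, hs, fun i => ?_⟩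
        show (s.channels i).Sublist (op.apply (Function.update s.channels c x) i)
        rw [hf]
        by_cases hi : i = c
        · subst hi
          simpa using hsub
        · simp [hi]
      · rintro ⟨u, ⟨hu, hu'⟩, _, ⟨⟨hc, he⟩, rfl⟩, hs, hs'⟩
        refine ⟨hs, fun i => ?_⟩
        have hi' : (s.channels i).Sublist (op.apply u.channels i) := hs' i
        rw [hf] at hi'
        show s.channels i ∈ productLang (Function.update σ.2 c Q i)
        by_cases hi : i = c
        · subst hi
          simp only [Function.update_self] at hi' ⊢
          exact (hQ _).2 ⟨_, hu' i, (hen _).1 he, hi'⟩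
        · simp only [Function.update_of_ne hi] at hi' ⊢
          exact productLang_lower hi' (hu' i)
  cases op with
  | send c a =>
    simp only [symbStep, hp, if_true, Option.some.injEq] at h
    refine key c _ (fun _ => True) (fun w => w ++ [a]) (fun _ => Iff.rfl) (fun _ => rfl) h.symm
      fun w => ?_
    simpa using mem_productLang_append_singleton
  | recv c a =>
    simp only [symbStep, hp, if_true, Option.map_eq_some_iff] at h
    obtain ⟨Q, hQ, h⟩ := h
    exact key c Q (fun w => a ∈ w) (dropThrough a) (fun _ => Iff.rfl) (fun _ => rfl) h.symm
      fun w => mem_productLang_residual hQ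

theorem primrec_symbStep (t : Fin q × ChannelOp k m × Fin q) : Primrec (symbStep t) := by
  obtain ⟨p, op, p'⟩ := t
  have hupd : ∀ c : Fin k, Primrec₂ fun (σ : SymbConfig q k m) (Q : List (Atom m)) =>
      ((p', Function.update σ.2 c Q) : SymbConfig q k m) := by
    intro c
    refine Primrec.pair (Primrec.const p') (Primrec.fin_curry.2 ?_)
    refine (Primrec.ite (Primrec.eq.comp Primrec.snd (Primrec.const c))
      (Primrec.snd.comp Primrec.fst)
      (Primrec.fin_app.comp (Primrec.snd.comp (Primrec.fst.comp Primrec.fst))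
        Primrec.snd)).of_eq ?_
    rintro ⟨⟨σ, Q⟩, i⟩
    simp [Function.update_apply]
  have hch : ∀ c : Fin k, Primrec fun σ : SymbConfig q k m => σ.2 c := fun c =>
    Primrec.fin_app.comp Primrec.snd (Primrec.const c)
  refine Primrec.ite (Primrec.eq.comp Primrec.fst (Primrec.const p)) ?_ (Primrec.const none)
  cases op with
  | send c a =>
    exact Primrec.option_some.comp ((hupd c).comp Primrec.id
      (Primrec.list_append.comp (hch c) (Primrec.const [Sum.inl a])))
  | recv c a =>
    exact Primrec.option_map (primrec_residual.comp (Primrec.const (Sum.inl a)) (hch c)) (hupd c)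

/-- The symbolic state with a given code. -/
def decodeSymb (q k m : ℕ) (e : ℕ) : Option (SymbConfig q k m) :=
  @Encodable.decode _ Primcodable.toEncodable e

/-- The code of a symbolic state. -/
def encodeSymb (σ : SymbConfig q k m) : ℕ :=
  @Encodable.encode _ Primcodable.toEncodable σ

theorem decodeSymb_encodeSymb (σ : SymbConfig q k m) : decodeSymb q k m (encodeSymb σ) = some σ :=
  @Encodable.encodek _ Primcodable.toEncodable σ

theorem primrec_decodeSymb : Primrec (decodeSymb q k m) :=
  Primrec.decode

theorem primrec_encodeSymb : Primrec (encodeSymb : SymbConfig q k m → ℕ) :=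
  Primrec.encode

theorem mem_wordProductRep {e : ℕ} {s : Order.Ideal (Config q k m)} :
    s ∈ wordProductRep q k m e ↔
      ∃ σ, decodeSymb q k m e = some σ ∧
        σ.toIdeal = s := by
  simp only [wordProductRep, Part.mem_coe, Option.mem_def, Option.map_eq_some_iff]
  rfl

theorem toIdeal_mem_wordProductRep (σ : SymbConfig q k m) :
    σ.toIdeal ∈ wordProductRep q k m (encodeSymb σ) :=
  mem_wordProductRep.2 ⟨σ, decodeSymb_encodeSymb σ, rfl⟩

theorem isDecidableVia_le : IsDecidableVia (wordProductRep q k m) (· ≤ ·) := by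
  let d : ℕ × ℕ → Bool := fun p =>
    (((decodeSymb q k m p.1).bind fun σ =>
      (decodeSymb q k m p.2).map fun τ => symbIncl σ τ)).getD false
  have hd : Primrec d := by
    refine Primrec.option_getD.comp (Primrec.option_bind (primrec_decodeSymb.comp Primrec.fst) ?_)
      (Primrec.const false)
    exact Primrec.option_map (primrec_decodeSymb.comp (Primrec.snd.comp Primrec.fst))
      (primrec_symbIncl.comp (Primrec.snd.comp Primrec.fst) Primrec.snd)
  refine ⟨fun p => Part.some (d p), hd.to_comp, ?_⟩
  intro e e' s s' hs hs'
  obtain ⟨σ, hσ, rfl⟩ := mem_wordProductRep.1 hs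
  obtain ⟨τ, hτ, rfl⟩ := mem_wordProductRep.1 hs'
  refine ⟨_, Part.mem_some _, ?_⟩
  simp [d, hσ, hτ, symbIncl_iff]

theorem isComputableVia_soberMap (t : Fin q × ChannelOp k m × Fin q) :
    IsComputableVia (wordProductRep q k m)
      (soberMap (FLCS.transitionMap t) (FLCS.isPartialMonotone_transitionMap t)) := by
  let g : ℕ → Option ℕ := fun e =>
    ((decodeSymb q k m e).bind (symbStep t)).map encodeSymb
  have hg : Primrec g := by
    exact Primrec.option_map (Primrec.option_bind primrec_decodeSymb
      ((primrec_symbStep t).comp Primrec.snd).to₂) (primrec_encodeSymb.comp Primrec.snd).to₂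
  refine ⟨fun e => Part.some (g e), hg.to_comp, ?_⟩
  intro e s hs
  obtain ⟨σ, hσ, rfl⟩ := mem_wordProductRep.1 hs
  rcases h : symbStep t σ with _ | τ
  · exact .inl ⟨by simp [g, hσ, h], symbStep_eq_none h⟩
  · exact .inr ⟨_, _, by simp [g, hσ, h], toIdeal_mem_wordProductRep τ, symbStep_eq_some h⟩

theorem FLCS.mem_post_completion (M : FLCS q k m) {σ : SymbConfig q k m}
    {s : Order.Ideal (Config q k m)} :
    s ∈ M.toFunctionalTS.completion.post σ.toIdeal ↔
      ∃ t ∈ M.transitions, ∃ τ, symbStep t σ = some τ ∧ τ.toIdeal = s := by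
  constructor
  · rintro ⟨_, ⟨⟨_, t, ht, rfl⟩, rfl⟩, hs⟩
    refine ⟨t, ht, ?_⟩
    rcases h : symbStep t σ with _ | τ
    · exact absurd (Part.dom_iff_mem.2 ⟨s, hs⟩) (symbStep_eq_none h)
    · exact ⟨τ, rfl, Part.mem_unique (symbStep_eq_some h) hs⟩
  · rintro ⟨t, ht, τ, h, rfl⟩
    exact ⟨_, ⟨⟨_, t, ht, rfl⟩, rfl⟩, symbStep_eq_some h⟩

theorem FLCS.isSetRecursiveVia_post (M : FLCS q k m) :
    IsSetRecursiveVia (wordProductRep q k m) M.toFunctionalTS.completion.post := by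
  have hstep : ∀ l : List (Fin q × ChannelOp k m × Fin q),
      Primrec fun σ : SymbConfig q k m => l.filterMap fun t => symbStep t σ := by
    intro l
    induction l with
    | nil => exact Primrec.const []
    | cons t l ih =>
      refine (Primrec.option_casesOn (primrec_symbStep t) ih
        (g := fun σ τ => τ :: l.filterMap fun t => symbStep t σ)
        (Primrec.list_cons.comp Primrec.snd (ih.comp Primrec.fst))).of_eq fun σ => ?_
      rw [List.filterMap_cons]
      cases symbStep t σ <;> rfl
  let g : ℕ → List ℕ := fun e =>
    ((decodeSymb q k m e).map fun σ =>
      (M.transitions.filterMap fun t => symbStep t σ).map encodeSymb).getD []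
  have hg : Primrec g := by
    refine Primrec.option_getD.comp (Primrec.option_map primrec_decodeSymb ?_) (Primrec.const [])
    exact Primrec.list_map ((hstep _).comp Primrec.snd) (primrec_encodeSymb.comp Primrec.snd)
  refine ⟨fun e => Part.some (g e), hg.to_comp, ?_⟩
  intro e s hs
  obtain ⟨σ, hσ, rfl⟩ := mem_wordProductRep.1 hs
  have hge : ∀ e', e' ∈ g e ↔
      ∃ t ∈ M.transitions, ∃ τ, symbStep t σ = some τ ∧ encodeSymb τ = e' := by
    intro e'
    simp only [g, hσ, Option.map_some, Option.getD_some, List.mem_map, List.mem_filterMap]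
    constructor
    · rintro ⟨τ, ⟨t, ht, h⟩, rfl⟩
      exact ⟨t, ht, τ, h, rfl⟩
    · rintro ⟨t, ht, τ, h, rfl⟩
      exact ⟨τ, ⟨t, ht, h⟩, rfl⟩
  refine ⟨g e, Part.mem_some _, ?_, ?_⟩
  · intro e' he'
    obtain ⟨t, -, τ, -, rfl⟩ := (hge e').1 he'
    exact Part.dom_iff_mem.2 ⟨_, toIdeal_mem_wordProductRep τ⟩
  · ext s
    rw [M.mem_post_completion]
    constructor
    · rintro ⟨e', he', hs'⟩
      obtain ⟨t, ht, τ, h, rfl⟩ := (hge e').1 he'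
      exact ⟨t, ht, τ, h, Part.mem_unique (toIdeal_mem_wordProductRep τ) hs'⟩
    · rintro ⟨t, ht, τ, h, rfl⟩
      exact ⟨_, (hge _).2 ⟨t, ht, τ, h, rfl⟩, toIdeal_mem_wordProductRep τ⟩

theorem FLCS.isEffectiveVia_completion (M : FLCS q k m) :
    M.toFunctionalTS.completion.IsEffectiveVia (wordProductRep q k m) := by
  refine ⟨fun s => ?_, isDecidableVia_le, ?_, M.isSetRecursiveVia_post⟩
  · obtain ⟨σ, rfl⟩ := SymbConfig.toIdeal_surjective s
    exact ⟨_, toIdeal_mem_wordProductRep σ⟩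
  · rintro _ ⟨⟨_, t, -, rfl⟩, rfl⟩
    exact isComputableVia_soberMap t

end Effective

/-! ### Counter machines with unreliable zero tests -/

/-- Instructions of counter machines. The instruction `move c d j₁ j₂` takes a unit from the
counter `c`, adds it to the counter `d`, and jumps to `j₁`, if `c` is not zero; else, it jumps to
`j₂`. The instruction `grow j` adds a unit to the counter `0`, and jumps to `j`. -/
inductive Instr where
  | move (c d j₁ j₂ : ℕ)
  | grow (j : ℕ)

/-- All counters of an instruction are at most `k`, and all jump targets are at most `l`. -/
def Instr.Bounded (k l : ℕ) : Instr → Prop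
  | move c d j₁ j₂ => c ≤ k ∧ d ≤ k ∧ j₁ ≤ l ∧ j₂ ≤ l
  | grow j => j ≤ l

/-- States of counter machines: the address of the current instruction, and the values of the
counters. -/
abbrev CounterState := ℕ × (ℕ → ℕ)

/-- Add a unit to the counter `d`. -/
def bump (d : ℕ) (v : ℕ → ℕ) : ℕ → ℕ := Function.update v d (v d + 1)

/-- The intended, deterministic, semantics of counter machines. An address beyond the code is a
halting state. -/
def perfectNext (code : List Instr) (x : CounterState) : Option CounterState :=
  match code[x.1]? with
  | some (.move c d j₁ j₂) =>
    if x.2 c = 0 then some (j₂, x.2) else some (j₁, bump d (Function.update x.2 c (x.2 c - 1)))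
  | some (.grow j) => some (j, bump 0 x.2)
  | none => none

/-- One step of the intended semantics. -/
def PerfectStep (code : List Instr) (x y : CounterState) : Prop := perfectNext code x = some y

/-- The lossy semantics: the zero test may succeed for a counter that is not zero, which is then
set to zero. -/
inductive LossyStep (code : List Instr) : CounterState → CounterState → Prop
  | move {s c d j₁ j₂ n : ℕ} {v : ℕ → ℕ} (h : code[s]? = some (.move c d j₁ j₂))
      (hc : v c = n + 1) : LossyStep code (s, v) (j₁, bump d (Function.update v c n))
  | reset {s c d j₁ j₂ : ℕ} {v : ℕ → ℕ} (h : code[s]? = some (.move c d j₁ j₂)) :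
      LossyStep code (s, v) (j₂, Function.update v c 0)
  | grow {s j : ℕ} {v : ℕ → ℕ} (h : code[s]? = some (.grow j)) :
      LossyStep code (s, v) (j, bump 0 v)

theorem PerfectStep.lossyStep {code : List Instr} {x y : CounterState}
    (h : PerfectStep code x y) : LossyStep code x y := by
  obtain ⟨s, v⟩ := x
  unfold PerfectStep perfectNext at h
  split at h
  · rename_i c d j₁ j₂ hs
    split_ifs at h with hc <;> cases h
    · have := LossyStep.reset (v := v) hs
      rwa [← (show v c = 0 from hc), Function.update_eq_self] at this
    · exact LossyStep.move hs (Nat.succ_pred_eq_of_ne_zero hc).symm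
  · rename_i j hs
    cases h
    exact LossyStep.grow hs
  · exact absurd h (by simp)

/-- The sum of the counters `0, …, k`. -/
def counterSum (k : ℕ) (v : ℕ → ℕ) : ℕ := ∑ i ∈ Finset.range (k + 1), v i

theorem counterSum_update {k c : ℕ} (hc : c ≤ k) (v : ℕ → ℕ) (n : ℕ) :
    counterSum k (Function.update v c n) + v c = counterSum k v + n := by
  unfold counterSum
  have hm : c ∈ Finset.range (k + 1) := by simpa using Nat.lt_succ_of_le hc
  rw [Finset.sum_update_of_mem hm, ← Finset.add_sum_erase _ v hm, Finset.sdiff_singleton_eq_erase]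
  omega

theorem counterSum_bump {k d : ℕ} (hd : d ≤ k) (v : ℕ → ℕ) :
    counterSum k (bump d v) = counterSum k v + 1 := by
  have := counterSum_update hd v (v d + 1)
  unfold bump
  omega

theorem le_counterSum {k c : ℕ} (hc : c ≤ k) (v : ℕ → ℕ) : v c ≤ counterSum k v :=
  Finset.single_le_sum (f := v) (fun _ _ => Nat.zero_le _) (by simpa using Nat.lt_succ_of_le hc)

/-! ### Functional-lossy channel systems simulate lossy counter machines -/

namespace CounterSim

/-- Control states of the channel system: each address comes with a main state, an intermediate
state after taking a unit from a counter, and an intermediate state after marking the end of a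
counter. -/
def ctl (l : ℕ) (b : Fin 3) (s : ℕ) : Fin (3 * (l + 1)) := finProdFinEquiv (b, Fin.ofNat (l + 1) s)

theorem ctl_inj {l : ℕ} {b b' : Fin 3} {s s' : ℕ} (hs : s ≤ l) (hs' : s' ≤ l)
    (h : ctl l b s = ctl l b' s') : b = b' ∧ s = s' := by
  have := finProdFinEquiv.injective h
  obtain ⟨h₁, h₂⟩ := Prod.mk.inj this
  refine ⟨h₁, ?_⟩
  have := congrArg Fin.val h₂
  simpa [Fin.ofNat, Nat.mod_eq_of_lt (Nat.lt_succ_of_le hs),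
    Nat.mod_eq_of_lt (Nat.lt_succ_of_le hs')] using this

/-- The channel of a counter. -/
def chn (k : ℕ) (c : ℕ) : Fin (k + 1) := Fin.ofNat (k + 1) c

theorem val_chn {k c : ℕ} (hc : c ≤ k) : (chn k c : ℕ) = c :=
  Nat.mod_eq_of_lt (Nat.lt_succ_of_le hc)

/-- The transitions for an instruction at address `s`. The counter value `n` is the channel
content `0ⁿ`. The zero test sends the end marker `1` and reads it again, which removes all
preceding letters. -/
def instrTransitions (k l s : ℕ) :
    Instr → List (Fin (3 * (l + 1)) × ChannelOp (k + 1) 2 × Fin (3 * (l + 1)))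
  | .move c d j₁ j₂ =>
    [(ctl l 0 s, .recv (chn k c) 0, ctl l 1 s), (ctl l 1 s, .send (chn k d) 0, ctl l 0 j₁),
      (ctl l 0 s, .send (chn k c) 1, ctl l 2 s), (ctl l 2 s, .recv (chn k c) 1, ctl l 0 j₂)]
  | .grow j => [(ctl l 0 s, .send (chn k 0) 0, ctl l 0 j)]

/-- The functional-lossy channel system that simulates a counter machine with counters
`0, …, k`. -/
def toFLCS (k : ℕ) (code : List Instr) : FLCS (3 * (code.length + 1)) (k + 1) 2 where
  transitions := code.zipIdx.flatMap fun p => instrTransitions k code.length p.2 p.1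

theorem mem_transitions_toFLCS {k : ℕ} {code : List Instr}
    {t : Fin (3 * (code.length + 1)) × ChannelOp (k + 1) 2 × Fin (3 * (code.length + 1))} :
    t ∈ (toFLCS k code).transitions ↔
      ∃ s ins, code[s]? = some ins ∧ t ∈ instrTransitions k code.length s ins := by
  simp only [toFLCS, List.mem_flatMap, Prod.exists, List.mem_zipIdx_iff_getElem?]
  exact ⟨fun ⟨ins, s, h, h'⟩ => ⟨s, ins, h, h'⟩, fun ⟨s, ins, h, h'⟩ => ⟨ins, s, h, h'⟩⟩

/-- The channel contents that represent the values of counters. -/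
def chans (k : ℕ) (v : ℕ → ℕ) : Fin (k + 1) → List (Fin 2) := fun i => List.replicate (v i) 0

/-- The configuration of the channel system that represents a state of the counter machine. -/
def encConfig (k l : ℕ) (x : CounterState) : Config (3 * (l + 1)) (k + 1) 2 :=
  ⟨ctl l 0 x.1, chans k x.2⟩

theorem apply_send_chans {k d : ℕ} (hd : d ≤ k) (v : ℕ → ℕ) :
    (ChannelOp.send (chn k d) 0).apply (chans k v) = chans k (bump d v) := by
  funext i
  by_cases hi : i = chn k d
  · subst hi
    simp [ChannelOp.apply, chans, bump, val_chn hd, List.replicate_succ']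
  · have : (i : ℕ) ≠ d := fun h => hi (Fin.ext (h.trans (val_chn hd).symm))
    simp [ChannelOp.apply, chans, bump, hi, this]

theorem apply_recv_chans {k c n : ℕ} (hc : c ≤ k) {v : ℕ → ℕ} (hv : v c = n + 1) :
    (ChannelOp.recv (chn k c) 0).apply (chans k v) = chans k (Function.update v c n) := by
  funext i
  by_cases hi : i = chn k c
  · subst hi
    simp [ChannelOp.apply, chans, val_chn hc, hv, List.replicate_succ, dropThrough]
  · have : (i : ℕ) ≠ c := fun h => hi (Fin.ext (h.trans (val_chn hc).symm))
    simp [ChannelOp.apply, chans, hi, this]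

theorem apply_recv_marked {k c : ℕ} (hc : c ≤ k) (v : ℕ → ℕ) :
    (ChannelOp.recv (chn k c) 1).apply ((ChannelOp.send (chn k c) 1).apply (chans k v)) =
      chans k (Function.update v c 0) := by
  funext i
  by_cases hi : i = chn k c
  · subst hi
    have : (1 : Fin 2) ∉ List.replicate (v c) 0 := by simp [List.mem_replicate]
    simp [ChannelOp.apply, chans, val_chn hc, dropThrough_append this]
  · have : (i : ℕ) ≠ c := fun h => hi (Fin.ext (h.trans (val_chn hc).symm))
    simp [ChannelOp.apply, chans, hi, this]

variable {k : ℕ} {code : List Instr}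

theorem step_of_mem {t : Fin (3 * (code.length + 1)) × ChannelOp (k + 1) 2 ×
    Fin (3 * (code.length + 1))} {s : ℕ} {ins : Instr} (h : code[s]? = some ins)
    (ht : t ∈ instrTransitions k code.length s ins) {w : Fin (k + 1) → List (Fin 2)}
    (hw : t.2.1.Enabled w) :
    (toFLCS k code).toFunctionalTS.Step ⟨t.1, w⟩ ⟨t.2.2, t.2.1.apply w⟩ :=
  ⟨_, ⟨t, mem_transitions_toFLCS.2 ⟨s, ins, h, ht⟩, rfl⟩, ⟨rfl, hw⟩, rfl⟩

theorem reach_of_lossyStep (hwf : ∀ ins ∈ code, ins.Bounded k code.length) {x y : CounterState}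
    (h : LossyStep code x y) :
    Relation.ReflTransGen (toFLCS k code).toFunctionalTS.Step (encConfig k code.length x)
      (encConfig k code.length y) := by
  cases h with
  | @move s c d j₁ j₂ n v h hc =>
    obtain ⟨hck, hdk, -, -⟩ := hwf _ (List.mem_of_getElem? h)
    have h₁ := step_of_mem (k := k) (w := chans k v) (t := (_, .recv (chn k c) 0, _)) h
      (.head _) (by simp [ChannelOp.Enabled, chans, val_chn hck, hc])
    have h₂ := step_of_mem (k := k) (w := chans k (Function.update v c n))
      (t := (_, .send (chn k d) 0, _)) h (.tail _ (.head _)) trivial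
    dsimp only at h₁ h₂
    rw [apply_recv_chans hck hc] at h₁
    rw [apply_send_chans hdk] at h₂
    exact .tail (.single h₁) h₂
  | @reset s c d j₁ j₂ v h =>
    obtain ⟨hck, hdk, -, -⟩ := hwf _ (List.mem_of_getElem? h)
    have h₁ := step_of_mem (k := k) (w := chans k v) (t := (_, .send (chn k c) 1, _)) h
      (.tail _ (.tail _ (.head _))) trivial
    have h₂ := step_of_mem (k := k) (w := (ChannelOp.send (chn k c) 1).apply (chans k v))
      (t := (_, .recv (chn k c) 1, _)) h (.tail _ (.tail _ (.tail _ (.head _))))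
      (by simp [ChannelOp.Enabled, ChannelOp.apply])
    dsimp only at h₁ h₂
    rw [apply_recv_marked hck] at h₂
    exact .tail (.single h₁) h₂
  | @grow s j v h =>
    have h₁ := step_of_mem (k := k) (w := chans k v) (t := (_, .send (chn k 0) 0, _)) h
      (.head _) trivial
    dsimp only at h₁
    rw [apply_send_chans (Nat.zero_le k)] at h₁
    exact .single h₁

/-- The configurations of the channel system that correspond to a state of the counter machine,
possibly in the middle of an instruction. -/
inductive Matches (k : ℕ) (code : List Instr) :
    CounterState → Config (3 * (code.length + 1)) (k + 1) 2 → Prop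
  | main (x : CounterState) (hx : x.1 ≤ code.length) :
      Matches k code x (encConfig k code.length x)
  | taken {s c d j₁ j₂ n : ℕ} {v : ℕ → ℕ} (h : code[s]? = some (.move c d j₁ j₂))
      (hc : v c = n + 1) :
      Matches k code (s, v) ⟨ctl code.length 1 s, chans k (Function.update v c n)⟩
  | marked {s c d j₁ j₂ : ℕ} {v : ℕ → ℕ} (h : code[s]? = some (.move c d j₁ j₂)) :
      Matches k code (s, v)
        ⟨ctl code.length 2 s, (ChannelOp.send (chn k c) 1).apply (chans k v)⟩

theorem le_length_of_getElem? {s : ℕ} {ins : Instr} (h : code[s]? = some ins) :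
    s ≤ code.length :=
  (List.getElem?_eq_some_iff.1 h).1.le

theorem matches_step (hwf : ∀ ins ∈ code, ins.Bounded k code.length) {x : CounterState}
    {y z : Config (3 * (code.length + 1)) (k + 1) 2} (hm : Matches k code x y)
    (h : (toFLCS k code).toFunctionalTS.Step y z) :
    ∃ x', Relation.ReflTransGen (LossyStep code) x x' ∧ Matches k code x' z := by
  obtain ⟨_, ⟨t, ht, rfl⟩, ⟨hctl, hen⟩, rfl⟩ := h
  obtain ⟨s', ins, hs', ht⟩ := mem_transitions_toFLCS.1 ht
  have hl' := le_length_of_getElem? hs'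
  have hb := hwf _ (List.mem_of_getElem? hs')
  cases hm with
  | main x hx =>
    obtain ⟨s, v⟩ := x
    cases ins with
    | move c d j₁ j₂ =>
      simp only [instrTransitions, List.mem_cons, List.not_mem_nil, or_false] at ht
      obtain ⟨hck, hdk, hj₁, hj₂⟩ := hb
      rcases ht with rfl | rfl | rfl | rfl
      · obtain ⟨-, rfl⟩ := ctl_inj hx hl' hctl
        have hv : 0 ∈ List.replicate (v (chn k c)) (0 : Fin 2) := hen
        rw [val_chn hck, List.mem_replicate] at hv
        obtain ⟨n, hn⟩ := Nat.exists_eq_succ_of_ne_zero hv.1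
        refine ⟨(s, v), .refl, ?_⟩
        have := Matches.taken (k := k) hs' hn
        rwa [← apply_recv_chans hck hn] at this
      · exact absurd (ctl_inj hx hl' hctl).1 (by decide)
      · obtain ⟨-, rfl⟩ := ctl_inj hx hl' hctl
        exact ⟨(s, v), .refl, Matches.marked hs'⟩
      · exact absurd (ctl_inj hx hl' hctl).1 (by decide)
    | grow j =>
      simp only [instrTransitions, List.mem_cons, List.not_mem_nil, or_false] at ht
      subst ht
      obtain ⟨-, rfl⟩ := ctl_inj hx hl' hctl
      refine ⟨_, .single (LossyStep.grow hs'), ?_⟩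
      have := Matches.main (k := k) (code := code) (j, bump 0 v) hb
      unfold encConfig at this
      rwa [← apply_send_chans (Nat.zero_le k)] at this
  | @taken s c' d' i₁ i₂ n v h hc =>
    have hl := le_length_of_getElem? h
    cases ins with
    | move c d j₁ j₂ =>
      simp only [instrTransitions, List.mem_cons, List.not_mem_nil, or_false] at ht
      obtain ⟨hck, hdk, hj₁, hj₂⟩ := hb
      rcases ht with rfl | rfl | rfl | rfl
      · exact absurd (ctl_inj hl hl' hctl).1 (by decide)
      · obtain ⟨-, rfl⟩ := ctl_inj hl hl' hctl
        obtain ⟨rfl, rfl, rfl, rfl⟩ := Instr.move.inj (Option.some.inj (hs'.symm.trans h))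
        refine ⟨_, .single (LossyStep.move hs' hc), ?_⟩
        have := Matches.main (k := k) (code := code) (j₁, bump d (Function.update v c n)) hj₁
        unfold encConfig at this
        rwa [← apply_send_chans hdk] at this
      · exact absurd (ctl_inj hl hl' hctl).1 (by decide)
      · exact absurd (ctl_inj hl hl' hctl).1 (by decide)
    | grow j =>
      simp only [instrTransitions, List.mem_cons, List.not_mem_nil, or_false] at ht
      subst ht
      exact absurd (ctl_inj hl hl' hctl).1 (by decide)
  | @marked s c' d' i₁ i₂ v h =>
    have hl := le_length_of_getElem? h
    cases ins with
    | move c d j₁ j₂ =>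
      simp only [instrTransitions, List.mem_cons, List.not_mem_nil, or_false] at ht
      obtain ⟨hck, hdk, hj₁, hj₂⟩ := hb
      rcases ht with rfl | rfl | rfl | rfl
      · exact absurd (ctl_inj hl hl' hctl).1 (by decide)
      · exact absurd (ctl_inj hl hl' hctl).1 (by decide)
      · exact absurd (ctl_inj hl hl' hctl).1 (by decide)
      · obtain ⟨-, rfl⟩ := ctl_inj hl hl' hctl
        obtain ⟨rfl, rfl, rfl, rfl⟩ := Instr.move.inj (Option.some.inj (hs'.symm.trans h))
        refine ⟨_, .single (LossyStep.reset hs'), ?_⟩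
        have := Matches.main (k := k) (code := code) (j₂, Function.update v c 0) hj₂
        unfold encConfig at this
        rwa [← apply_recv_marked hck] at this
    | grow j =>
      simp only [instrTransitions, List.mem_cons, List.not_mem_nil, or_false] at ht
      subst ht
      exact absurd (ctl_inj hl hl' hctl).1 (by decide)

theorem matches_reach (hwf : ∀ ins ∈ code, ins.Bounded k code.length) {x : CounterState}
    (hx : x.1 ≤ code.length) {y : Config (3 * (code.length + 1)) (k + 1) 2}
    (h : Relation.ReflTransGen (toFLCS k code).toFunctionalTS.Step
      (encConfig k code.length x) y) :
    ∃ x', Relation.ReflTransGen (LossyStep code) x x' ∧ Matches k code x' y := by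
  induction h with
  | refl => exact ⟨x, .refl, .main x hx⟩
  | tail _ hs ih =>
    obtain ⟨x', hx', hm⟩ := ih
    obtain ⟨x'', hx'', hm'⟩ := matches_step hwf hm hs
    exact ⟨x'', hx'.trans hx'', hm'⟩

/-- Every main configuration that the channel system can reach represents a reachable state of the
lossy counter machine. -/
theorem exists_lossy_of_reach (hwf : ∀ ins ∈ code, ins.Bounded k code.length) {x : CounterState}
    (hx : x.1 ≤ code.length) {y : Config (3 * (code.length + 1)) (k + 1) 2}
    (h : Relation.ReflTransGen (toFLCS k code).toFunctionalTS.Step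
      (encConfig k code.length x) y) {s : ℕ} (hs : s ≤ code.length)
    (hy : y.control = ctl code.length 0 s) :
    ∃ v, Relation.ReflTransGen (LossyStep code) x (s, v) ∧ y = encConfig k code.length (s, v) := by
  obtain ⟨x', hx', hm⟩ := matches_reach hwf hx h
  cases hm with
  | main x' hl =>
    obtain ⟨s', v⟩ := x'
    obtain ⟨-, rfl⟩ := ctl_inj hl hs hy
    exact ⟨v, hx', rfl⟩
  | taken h' _ => exact absurd (ctl_inj (le_length_of_getElem? h') hs hy).1 (by decide)
  | marked h' => exact absurd (ctl_inj (le_length_of_getElem? h') hs hy).1 (by decide)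

end CounterSim

/-! ### Programs for primitive recursive functions -/

/-- Structured programs on registers. The program `copy x t o` adds the value of `x` to `o`, using
the register `t`, with initial value zero, to restore `x`. The program `loop r p` decrements `r`
and executes `p` as long as `r` is not zero. -/
inductive Prog where
  | inc (r : ℕ)
  | clear (r : ℕ)
  | copy (x t o : ℕ)
  | loop (r : ℕ) (p : Prog)
  | seq (p q : Prog)

namespace Prog

/-- Big-step semantics of programs. -/
inductive Exec : Prog → (ℕ → ℕ) → (ℕ → ℕ) → Prop
  | inc (r : ℕ) (σ : ℕ → ℕ) : Exec (inc r) σ (bump r σ)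
  | clear (r : ℕ) (σ : ℕ → ℕ) : Exec (clear r) σ (Function.update σ r 0)
  | copy {x t o : ℕ} {σ : ℕ → ℕ} (ht : σ t = 0) :
      Exec (copy x t o) σ (Function.update σ o (σ o + σ x))
  | loop_zero {r : ℕ} {p : Prog} {σ : ℕ → ℕ} (h : σ r = 0) : Exec (loop r p) σ σ
  | loop_succ {r n : ℕ} {p : Prog} {σ σ₁ σ₂ : ℕ → ℕ} (h : σ r = n + 1)
      (h₁ : Exec p (Function.update σ r n) σ₁) (h₂ : Exec (loop r p) σ₁ σ₂) :
      Exec (loop r p) σ σ₂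
  | seq {p q : Prog} {σ σ₁ σ₂ : ℕ → ℕ} (h₁ : Exec p σ σ₁) (h₂ : Exec q σ₁ σ₂) :
      Exec (seq p q) σ σ₂

/-- A program is guarded if it uses only registers from `3` on, apart from copying the value of
register `1` using register `2`, and if the registers of copy commands are distinct. -/
def Guarded : Prog → Prop
  | inc r => 3 ≤ r
  | clear r => 3 ≤ r
  | copy x t o => 3 ≤ o ∧ x ≠ t ∧ x ≠ o ∧ t ≠ o ∧ ((3 ≤ x ∧ 3 ≤ t) ∨ (x = 1 ∧ t = 2))
  | loop r p => 3 ≤ r ∧ p.Guarded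
  | seq p q => p.Guarded ∧ q.Guarded

/-- The greatest register of a program. -/
def maxReg : Prog → ℕ
  | inc r => r
  | clear r => r
  | copy x t o => max x (max t o)
  | loop r p => max r p.maxReg
  | seq p q => max p.maxReg q.maxReg

/-- Clearing a block of registers. -/
theorem exists_clear_block {b : ℕ} (hb : 3 ≤ b) (n : ℕ) :
    ∃ p : Prog, p.Guarded ∧
      ∀ σ, σ (b + n) = 0 → Exec p σ fun r => if b ≤ r ∧ r < b + n then 0 else σ r := by
  suffices h : ∀ j ≤ n, ∃ p : Prog, p.Guarded ∧
      ∀ σ, σ (b + n) = 0 → Exec p σ fun r => if b ≤ r ∧ r < b + j then 0 else σ r from h n le_rfl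
  intro j
  induction j with
  | zero =>
    refine fun _ => ⟨clear (b + n), by simp only [Guarded]; omega, fun σ hσ => ?_⟩
    convert Exec.clear (b + n) σ using 1
    funext r
    rw [Function.update_apply]
    grind
  | succ j ih =>
    intro hj
    obtain ⟨p, hp, h⟩ := ih (by omega)
    refine ⟨seq p (clear (b + j)), ⟨hp, by simp only [Guarded]; omega⟩, fun σ hσ => ?_⟩
    convert Exec.seq (h σ hσ) (Exec.clear (b + j) _) using 1
    funext r
    rw [Function.update_apply]
    grind

/-- Every primitive recursive function is computed by a guarded program, for given input registers
`xs`, a given output register `o`, and a given lower bound `b` of the scratch registers, which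
have initial and final value zero. -/
theorem exists_prog_of_primrec {n : ℕ} {f : List.Vector ℕ n → ℕ} (hf : Nat.Primrec' f) :
    ∀ (xs : Fin n → ℕ) (o b : ℕ), (∀ i, 3 ≤ xs i ∧ xs i < b ∧ xs i ≠ o) → 3 ≤ o → o < b →
      ∃ p : Prog, p.Guarded ∧ ∀ (σ : ℕ → ℕ) (v : List.Vector ℕ n), (∀ i, σ (xs i) = v.get i) →
        (∀ r, b ≤ r → σ r = 0) → σ o = 0 → Exec p σ (Function.update σ o (f v)) := by
  induction hf with
  | zero =>
    exact fun _ o _ _ ho _ => ⟨clear o, ho, fun σ v _ _ _ => Exec.clear o σ⟩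
  | succ =>
    intro xs o b hxs ho hob
    refine ⟨seq (copy (xs 0) b o) (inc o), ⟨⟨ho, ?_⟩, ho⟩, fun σ v hv hb hσ => ?_⟩
    · have := hxs 0
      omega
    · convert Exec.seq (Exec.copy (x := xs 0) (o := o) (hb b le_rfl)) (Exec.inc o _) using 1
      have := hv 0
      rw [List.Vector.get_zero] at this
      simp [bump, hσ, this]
  | get i =>
    intro xs o b hxs ho hob
    refine ⟨copy (xs i) b o, ⟨ho, ?_⟩, fun σ v hv hb hσ => ?_⟩
    · have := hxs i
      omega
    · convert Exec.copy (x := xs i) (o := o) (hb b le_rfl) using 1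
      simp [hσ, hv]
  | @comp m n f g hf hg ihf ihg =>
    intro xs o b hxs ho hob
    -- The values of the inner functions are computed into the registers `b, …, b + n - 1`.
    have hinner : ∀ j ≤ n, ∃ p : Prog, p.Guarded ∧ ∀ (σ : ℕ → ℕ) (v : List.Vector ℕ m),
        (∀ i, σ (xs i) = v.get i) → (∀ r, b ≤ r → σ r = 0) →
        Exec p σ fun r => if h : b ≤ r ∧ r < b + j ∧ r - b < n then g ⟨r - b, h.2.2⟩ v
          else σ r := by
      intro j
      induction j with
      | zero =>
        refine fun _ => ⟨clear b, by simp only [Guarded]; omega, fun σ v _ hb => ?_⟩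
        convert Exec.clear b σ using 1
        funext r
        rw [Function.update_apply]
        grind
      | succ j ih =>
        intro hj
        obtain ⟨p, hp, h⟩ := ih (by omega)
        obtain ⟨p', hp', h'⟩ := ihg ⟨j, hj⟩ xs (b + j) (b + n)
          (fun i => by have := hxs i; omega) (by omega) (by omega)
        refine ⟨seq p p', ⟨hp, hp'⟩, fun σ v hv hb => ?_⟩
        convert Exec.seq (h σ v hv hb) (h' _ v (fun i => ?_) (fun r hr => ?_) ?_) using 1
        · funext r
          rw [Function.update_apply]
          by_cases hr : r = b + j
          · subst hr
            have : b ≤ b + j ∧ b + j < b + (j + 1) ∧ b + j - b < n := by omega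
            rw [if_pos rfl, dif_pos this]
            simp only [Nat.add_sub_cancel_left]
          · rw [if_neg hr]
            have : (b ≤ r ∧ r < b + (j + 1) ∧ r - b < n) ↔ (b ≤ r ∧ r < b + j ∧ r - b < n) := by
              omega
            simp only [this]
        · have := hxs i
          rw [dif_neg (by omega), hv]
        · rw [dif_neg (by omega), hb r (by omega)]
        · rw [dif_neg (by omega), hb _ (by omega)]
    obtain ⟨p, hp, h⟩ := hinner n le_rfl
    obtain ⟨p', hp', h'⟩ := ihf (fun i => b + i) o (b + n)
      (fun i => by have := i.2; omega) ho (by omega)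
    obtain ⟨p'', hp'', h''⟩ := exists_clear_block (b := b) (by omega) n
    refine ⟨seq p (seq p' p''), ⟨hp, hp', hp''⟩, fun σ v hv hb hσ => ?_⟩
    convert Exec.seq (h σ v hv hb) (Exec.seq
      (h' _ (List.Vector.ofFn fun i => g i v) (fun i => ?_) (fun r hr => ?_) ?_) (h'' _ ?_)) using 1
    · funext r
      simp only [Function.update_apply]
      by_cases hr : r = o
      · rw [if_pos hr, if_neg (by omega), if_pos hr]
      · rw [if_neg hr, if_neg hr]
        by_cases hbr : b ≤ r ∧ r < b + n
        · rw [if_pos hbr, hb r hbr.1]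
        · rw [if_neg hbr, dif_neg (by omega)]
    · have := i.2
      rw [dif_pos (by omega)]
      simp
    · rw [dif_neg (by omega), hb r (by omega)]
    · rw [dif_neg (by omega), hσ]
    · rw [Function.update_of_ne (by omega), dif_neg (by omega), hb _ (by omega)]
  | @prec n f g hf hg ihf ihg =>
    intro xs o b hxs ho hob
    obtain ⟨p, hp, h⟩ := ihf (fun i => xs i.succ) o (b + 3)
      (fun i => by have := hxs i.succ; omega) ho (by omega)
    obtain ⟨p', hp', h'⟩ := ihg (Fin.cons (b + 1) (Fin.cons o fun i => xs i.succ)) (b + 2) (b + 3)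
      (fun i => by
        refine Fin.cases ?_ (fun i => Fin.cases ?_ (fun i => ?_) i) i
        · simp only [Fin.cons_zero]
          omega
        · simp only [Fin.cons_succ, Fin.cons_zero]
          omega
        · have := hxs i.succ
          simp only [Fin.cons_succ]
          omega) (by omega) (by omega)
    -- Register `b` is the loop counter, `b + 1` is the recursion variable, and `b + 2` holds the
    -- next value.
    let body := seq p' (seq (clear o) (seq (copy (b + 2) (b + 3) o)
      (seq (clear (b + 2)) (inc (b + 1)))))
    have hx0 := hxs 0
    refine ⟨seq (copy (xs 0) (b + 1) b) (seq p (seq (loop b body) (clear (b + 1)))), ?_, ?_⟩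
    · simp only [Guarded, body]
      refine ⟨?_, hp, ⟨?_, hp', ?_⟩, ?_⟩ <;> omega
    · intro σ v hv hb hσ
      let R : ℕ → ℕ := fun j => Nat.rec (f v.tail) (fun y IH => g (y ::ᵥ IH ::ᵥ v.tail)) j
      let S : ℕ → ℕ → ℕ → ℕ := fun j c r =>
        if r = b then c else if r = b + 1 then j else if r = o then R j else σ r
      have hbody : ∀ j c, Exec body (S j c) (S (j + 1) c) := by
        intro j c
        have h₁ := h' (S j c) (j ::ᵥ R j ::ᵥ v.tail) (fun i => by
          refine Fin.cases ?_ (fun i => Fin.cases ?_ (fun i => ?_) i) i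
          · simp [S]
          · simp only [Fin.cons_succ, Fin.cons_zero, List.Vector.get_cons_succ,
              List.Vector.get_cons_zero, S]
            rw [if_neg (by omega), if_neg (by omega), if_pos trivial]
          · have := hxs i.succ
            simp only [Fin.cons_succ, List.Vector.get_cons_succ, List.Vector.get_tail_succ, S]
            rw [if_neg (by omega), if_neg (by omega), if_neg (by omega), hv])
          (fun r hr => by
            simp only [S]
            rw [if_neg (by omega), if_neg (by omega), if_neg (by omega), hb r (by omega)])
          (by
            simp only [S]
            rw [if_neg (by omega), if_neg (by omega), if_neg (by omega), hb _ (by omega)])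
        have hR : g (j ::ᵥ R j ::ᵥ v.tail) = R (j + 1) := rfl
        rw [hR] at h₁
        convert Exec.seq h₁ (Exec.seq (Exec.clear o _) (Exec.seq
          (Exec.copy (x := b + 2) (t := b + 3) (o := o) ?_)
          (Exec.seq (Exec.clear (b + 2) _) (Exec.inc (b + 1) _)))) using 1
        · have h3 : σ (b + 2) = 0 := hb _ (by omega)
          funext r
          simp only [bump, Function.update_apply, S]
          clear_value R
          clear h h' h₁ body hR hv hxs hx0 hb ihf ihg
          grind
        · simp only [Function.update_apply, S]
          rw [if_neg (by omega), if_neg (by omega), if_neg (by omega), if_neg (by omega),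
            if_neg (by omega), hb _ (by omega)]
      have hloop : ∀ c j, Exec (loop b body) (S j c) (S (j + c) 0) := by
        intro c
        induction c with
        | zero => exact fun j => Exec.loop_zero (by simp [S])
        | succ c ih =>
          intro j
          refine Exec.loop_succ (n := c) (by simp [S]) (σ₁ := S (j + 1) c) ?_ ?_
          · convert hbody j c using 1
            funext r
            simp only [Function.update_apply, S]
            split_ifs <;> rfl
          · have := ih (j + 1)
            rwa [Nat.add_right_comm] at this
      have h0 : σ (xs 0) = v.head := by rw [hv, List.Vector.get_zero]
      have hσb : σ b = 0 := hb b le_rfl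
      have hσb1 : σ (b + 1) = 0 := hb _ (by omega)
      convert Exec.seq (Exec.copy (x := xs 0) (t := b + 1) (o := b) hσb1)
        (Exec.seq (h _ v.tail (fun i => ?_) (fun r hr => ?_) ?_)
          (Exec.seq (σ₁ := S v.head 0) ?_ (Exec.clear (b + 1) _))) using 1
      · funext r
        simp only [Function.update_apply, S, R]
        split_ifs <;> first | rfl | omega | simp_all
      · have := hxs i.succ
        rw [Function.update_of_ne (by omega), hv, List.Vector.get_tail_succ]
      · rw [Function.update_of_ne (by omega), hb r (by omega)]
      · rw [Function.update_of_ne (by omega), hσ]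
      · have := hloop v.head 0
        rw [Nat.zero_add] at this
        convert this using 1
        funext r
        simp only [Function.update_apply, S, R]
        split_ifs <;> first | rfl | omega | simp_all

end Prog

/-! ### Compilation of programs to counter machines with a bounded budget -/

/-- The sum of the counters `1, …, k`. -/
def regSum (k : ℕ) (σ : ℕ → ℕ) : ℕ := ∑ i ∈ Finset.range k, σ (i + 1)

theorem counterSum_eq (k : ℕ) (v : ℕ → ℕ) : counterSum k v = regSum k v + v 0 :=
  Finset.sum_range_succ' v k

theorem regSum_update {k c : ℕ} (h1 : 1 ≤ c) (hc : c ≤ k) (σ : ℕ → ℕ) (n : ℕ) :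
    regSum k (Function.update σ c n) + σ c = regSum k σ + n := by
  have h := counterSum_update hc σ n
  rw [counterSum_eq, counterSum_eq, Function.update_of_ne (by omega)] at h
  omega

theorem regSum_bump {k d : ℕ} (h1 : 1 ≤ d) (hd : d ≤ k) (σ : ℕ → ℕ) :
    regSum k (bump d σ) = regSum k σ + 1 := by
  have h := regSum_update h1 hd σ (σ d + 1)
  unfold bump
  omega

theorem le_regSum {k c : ℕ} (h1 : 1 ≤ c) (hc : c ≤ k) (σ : ℕ → ℕ) : σ c ≤ regSum k σ := by
  have h := regSum_update h1 hc σ 0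
  omega

/-- The counters with the values of `σ` for the registers from `1` on, and with the remainder of a
total budget `T` in the counter `0`. -/
def withBudget (k T : ℕ) (σ : ℕ → ℕ) : ℕ → ℕ := Function.update σ 0 (T - regSum k σ)

theorem withBudget_of_ne {k T c : ℕ} (hc : c ≠ 0) (σ : ℕ → ℕ) : withBudget k T σ c = σ c :=
  Function.update_of_ne hc _ _

theorem withBudget_zero {k T : ℕ} (σ : ℕ → ℕ) : withBudget k T σ 0 = T - regSum k σ :=
  Function.update_self _ _ _

theorem counterSum_withBudget {k T : ℕ} {σ : ℕ → ℕ} (h : regSum k σ ≤ T) :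
    counterSum k (withBudget k T σ) = T := by
  have : regSum k (withBudget k T σ) = regSum k σ :=
    Finset.sum_congr rfl fun i _ => withBudget_of_ne (by omega) σ
  rw [counterSum_eq, this, withBudget_zero]
  omega

/-- Runs of the intended semantics. -/
abbrev PerfectReach (code : List Instr) : CounterState → CounterState → Prop :=
  Relation.ReflTransGen (PerfectStep code)

/-- The machine runs from address `b` and registers `σ` to address `e` and registers `σ'` if the
budget is large enough. If the budget is too small, it may also abort, by a jump to address
`0`. -/
def Runs (code : List Instr) (k b : ℕ) (σ : ℕ → ℕ) (e : ℕ) (σ' : ℕ → ℕ) : Prop :=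
  ∃ B, ∀ T, regSum k σ ≤ T →
    (regSum k σ' ≤ T ∧ PerfectReach code (b, withBudget k T σ) (e, withBudget k T σ')) ∨
      (T < B ∧ ∃ v, PerfectReach code (b, withBudget k T σ) (0, v))

namespace Runs

variable {code : List Instr} {k : ℕ}

theorem trans {b b' e : ℕ} {σ σ' σ'' : ℕ → ℕ} (h : Runs code k b σ b' σ')
    (h' : Runs code k b' σ' e σ'') : Runs code k b σ e σ'' := by
  obtain ⟨B, h⟩ := h
  obtain ⟨B', h'⟩ := h'
  refine ⟨max B B', fun T hT => ?_⟩
  rcases h T hT with ⟨hT', hr⟩ | ⟨hB, v, hv⟩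
  · rcases h' T hT' with ⟨hT'', hr'⟩ | ⟨hB', v, hv⟩
    · exact .inl ⟨hT'', hr.trans hr'⟩
    · exact .inr ⟨lt_max_of_lt_right hB', v, hr.trans hv⟩
  · exact .inr ⟨lt_max_of_lt_left hB, v, hv⟩

theorem of_step {b e : ℕ} {σ σ' : ℕ → ℕ}
    (h : ∀ T, regSum k σ ≤ T → regSum k σ' ≤ T ∧
      PerfectStep code (b, withBudget k T σ) (e, withBudget k T σ')) : Runs code k b σ e σ' :=
  ⟨0, fun T hT => .inl ⟨(h T hT).1, .single (h T hT).2⟩⟩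

theorem zero {b c d j₁ j₂ : ℕ} {σ : ℕ → ℕ} (h : code[b]? = some (.move c d j₁ j₂)) (hc : 1 ≤ c)
    (hσ : σ c = 0) : Runs code k b σ j₂ σ := by
  refine of_step fun T hT => ⟨hT, ?_⟩
  simp [PerfectStep, perfectNext, h, withBudget_of_ne (Nat.one_le_iff_ne_zero.1 hc), hσ]

theorem dec {b c j₁ j₂ n : ℕ} {σ : ℕ → ℕ} (h : code[b]? = some (.move c 0 j₁ j₂)) (hc : 1 ≤ c)
    (hck : c ≤ k) (hσ : σ c = n + 1) : Runs code k b σ j₁ (Function.update σ c n) := by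
  have hw := regSum_update hc hck σ n
  refine of_step fun T hT => ⟨by omega, ?_⟩
  have hc0 : c ≠ 0 := by omega
  simp only [PerfectStep, perfectNext, h, withBudget_of_ne hc0, hσ, Nat.succ_ne_zero, if_false,
    Option.some.injEq, Prod.mk.injEq, true_and, Nat.add_sub_cancel]
  funext r
  simp only [bump, withBudget, Function.update_apply]
  grind

theorem move {b c d j₁ j₂ n : ℕ} {σ : ℕ → ℕ} (h : code[b]? = some (.move c d j₁ j₂)) (hc : 1 ≤ c)
    (hck : c ≤ k) (hd : 1 ≤ d) (hdk : d ≤ k) (hσ : σ c = n + 1) :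
    Runs code k b σ j₁ (bump d (Function.update σ c n)) := by
  have hw := regSum_update hc hck σ n
  have hw' := regSum_bump hd hdk (Function.update σ c n)
  refine of_step fun T hT => ⟨by omega, ?_⟩
  have hc0 : c ≠ 0 := by omega
  simp only [PerfectStep, perfectNext, h, withBudget_of_ne hc0, hσ, Nat.succ_ne_zero, if_false,
    Option.some.injEq, Prod.mk.injEq, true_and, Nat.add_sub_cancel]
  have hw'' : regSum k (bump d (Function.update σ c n)) = regSum k σ := by omega
  unfold withBudget
  rw [hw'']
  funext r
  simp only [bump, Function.update_apply]
  grind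

theorem inc {b d j : ℕ} {σ : ℕ → ℕ} (h : code[b]? = some (.move 0 d j 0)) (hd : 1 ≤ d)
    (hdk : d ≤ k) : Runs code k b σ j (bump d σ) := by
  have hw := regSum_bump hd hdk σ
  refine ⟨regSum k σ + 1, fun T hT => ?_⟩
  by_cases hT' : T = regSum k σ
  · refine .inr ⟨by omega, withBudget k T σ, .single ?_⟩
    simp [PerfectStep, perfectNext, h, withBudget_zero, hT']
  · refine .inl ⟨by omega, .single ?_⟩
    have : T - regSum k σ ≠ 0 := by omega
    simp only [PerfectStep, perfectNext, h, withBudget_zero, this, if_false,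
      Option.some.injEq, Prod.mk.injEq, true_and]
    unfold withBudget
    rw [hw]
    funext r
    simp only [bump, Function.update_apply]
    grind

end Runs

/-- The code `l` stands at address `b`. -/
def CodeAt (code : List Instr) (b : ℕ) (l : List Instr) : Prop :=
  ∀ i ins, l[i]? = some ins → code[b + i]? = some ins

theorem CodeAt.cons {code l : List Instr} {b : ℕ} {ins : Instr} (h : CodeAt code b (ins :: l)) :
    code[b]? = some ins ∧ CodeAt code (b + 1) l :=
  ⟨h 0 ins rfl, fun i ins' hi => by
    rw [Nat.add_right_comm]
    exact h (i + 1) ins' hi⟩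

theorem CodeAt.append {code l l' : List Instr} {b : ℕ} (h : CodeAt code b (l ++ l')) :
    CodeAt code b l ∧ CodeAt code (b + l.length) l' :=
  ⟨fun i ins hi => h i ins (by
      rw [List.getElem?_append_left (List.getElem?_eq_some_iff.1 hi).1]
      exact hi),
    fun i ins hi => by
      rw [Nat.add_assoc]
      exact h _ ins (by
        rw [List.getElem?_append_right (by omega), Nat.add_sub_cancel_left]
        exact hi)⟩

theorem codeAt_append_append (l l' l'' : List Instr) : CodeAt (l ++ (l' ++ l'')) l.length l' := by
  intro i ins hi
  rw [List.getElem?_append_right (by omega), Nat.add_sub_cancel_left,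
    List.getElem?_append_left (List.getElem?_eq_some_iff.1 hi).1]
  exact hi

namespace Prog

/-- The number of instructions of the compiled program. -/
def size : Prog → ℕ
  | inc _ => 1
  | clear _ => 1
  | copy _ _ _ => 3
  | loop _ p => p.size + 1
  | seq p q => p.size + q.size

theorem size_pos (p : Prog) : 0 < p.size := by
  induction p with
  | inc | clear | copy | loop => simp [size]
  | seq p q ihp _ => exact Nat.lt_of_lt_of_le ihp (Nat.le_add_right _ _)

/-- The code of a program, at address `b` and with exit address `e`. Incrementing a register takes
a unit from the counter `0`, and aborts by a jump to address `0` if there is none. Decrementing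
a register gives the unit back. -/
def compile : Prog → ℕ → ℕ → List Instr
  | inc r, _, e => [.move 0 r e 0]
  | clear r, b, e => [.move r 0 b e]
  | copy x t o, b, e => [.move x t (b + 1) (b + 2), .move 0 o b 0, .move t x (b + 2) e]
  | loop r p, b, e => .move r 0 (b + 1) e :: p.compile (b + 1) b
  | seq p q, b, e => p.compile b (b + p.size) ++ q.compile (b + p.size) e

theorem length_compile (p : Prog) (b e : ℕ) : (p.compile b e).length = p.size := by
  induction p generalizing b e with
  | inc | clear | copy => rfl
  | loop r p ih => simp [compile, size, ih]
  | seq p q ihp ihq => simp [compile, size, ihp, ihq]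

/-- The compiled code consists of move instructions that do not mix the counters `1` and `2` with
the others, and that jump inside the code, to the exit address, or to `0`. -/
theorem compile_spec {p : Prog} (hp : p.Guarded) {b e : ℕ} {ins : Instr}
    (h : ins ∈ p.compile b e) :
    ∃ c d j₁ j₂, ins = .move c d j₁ j₂ ∧ c ≤ p.maxReg ∧ d ≤ p.maxReg ∧
      ((c = 1 ∨ c = 2) ↔ (d = 1 ∨ d = 2)) ∧
      (j₁ = 0 ∨ j₁ = e ∨ (b ≤ j₁ ∧ j₁ < b + p.size)) ∧
      (j₂ = 0 ∨ j₂ = e ∨ (b ≤ j₂ ∧ j₂ < b + p.size)) := by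
  induction p generalizing b e with
  | inc r =>
    simp only [compile, List.mem_singleton] at h
    simp only [Guarded] at hp
    refine ⟨_, _, _, _, h, ?_⟩
    grind [maxReg, size]
  | clear r =>
    simp only [compile, List.mem_singleton] at h
    simp only [Guarded] at hp
    refine ⟨_, _, _, _, h, ?_⟩
    grind [maxReg, size]
  | copy x t o =>
    simp only [compile, List.mem_cons, List.not_mem_nil, or_false] at h
    simp only [Guarded] at hp
    rcases h with h | h | h <;> refine ⟨_, _, _, _, h, ?_⟩ <;> grind [maxReg, size]
  | loop r p ih =>
    simp only [compile, List.mem_cons] at h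
    obtain ⟨hr, hp⟩ := hp
    rcases h with h | h
    · refine ⟨_, _, _, _, h, ?_⟩
      have hs := p.size_pos
      grind [maxReg, size]
    · obtain ⟨c, d, j₁, j₂, h, h'⟩ := ih hp h
      refine ⟨_, _, _, _, h, ?_⟩
      grind [maxReg, size]
  | seq p q ihp ihq =>
    simp only [compile, List.mem_append] at h
    have hs := q.size_pos
    rcases h with h | h
    · obtain ⟨c, d, j₁, j₂, h, h'⟩ := ihp hp.1 h
      refine ⟨_, _, _, _, h, ?_⟩
      grind [maxReg, size]
    · obtain ⟨c, d, j₁, j₂, h, h'⟩ := ihq hp.2 h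
      refine ⟨_, _, _, _, h, ?_⟩
      grind [maxReg, size]

theorem runs_clear {code : List Instr} {k b e r : ℕ} (h : code[b]? = some (.move r 0 b e))
    (hr : 1 ≤ r) (hrk : r ≤ k) (σ : ℕ → ℕ) : Runs code k b σ e (Function.update σ r 0) := by
  generalize hn : σ r = n
  induction n generalizing σ with
  | zero =>
    rw [← hn, Function.update_eq_self]
    exact Runs.zero h hr hn
  | succ n ih =>
    have := ih (Function.update σ r n) (Function.update_self _ _ _)
    rw [Function.update_idem] at this
    exact (Runs.dec h hr hrk hn).trans this

/-- The first loop of a copy command: the register `x` is moved to both `t` and `o`. -/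
theorem runs_copy_forth {code : List Instr} {k b e x t o : ℕ}
    (h : code[b]? = some (.move x t (b + 1) e)) (h' : code[b + 1]? = some (.move 0 o b 0))
    (hx : 1 ≤ x) (hxk : x ≤ k) (ht : 1 ≤ t) (htk : t ≤ k) (ho : 1 ≤ o) (hok : o ≤ k)
    (hxt : x ≠ t) (hxo : x ≠ o) (hto : t ≠ o) (σ : ℕ → ℕ) :
    Runs code k b σ e (Function.update (Function.update (Function.update σ x 0) t (σ t + σ x))
      o (σ o + σ x)) := by
  generalize hn : σ x = n
  induction n generalizing σ with
  | zero =>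
    convert Runs.zero h hx hn using 1
    funext r
    simp only [Function.update_apply]
    grind
  | succ n ih =>
    refine (Runs.move h hx hxk ht htk hn).trans ((Runs.inc h' ho hok).trans ?_)
    convert ih _ ?_ using 1
    · funext r
      simp only [bump, Function.update_apply]
      grind
    · simp only [bump, Function.update_apply]
      grind

/-- The second loop of a copy command: the register `t` is moved to `x`. -/
theorem runs_copy_back {code : List Instr} {k b e x t : ℕ}
    (h : code[b]? = some (.move t x b e)) (hx : 1 ≤ x) (hxk : x ≤ k) (ht : 1 ≤ t) (htk : t ≤ k)
    (hxt : x ≠ t) (σ : ℕ → ℕ) :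
    Runs code k b σ e (Function.update (Function.update σ t 0) x (σ x + σ t)) := by
  generalize hn : σ t = n
  induction n generalizing σ with
  | zero =>
    convert Runs.zero h ht hn using 1
    funext r
    simp only [Function.update_apply]
    grind
  | succ n ih =>
    refine (Runs.move h ht htk hx hxk hn).trans ?_
    convert ih _ ?_ using 1
    · funext r
      simp only [bump, Function.update_apply]
      grind
    · simp only [bump, Function.update_apply]
      grind

theorem Exec.runs {p : Prog} {σ σ' : ℕ → ℕ} (h : Exec p σ σ') {code : List Instr} {k b e : ℕ}
    (hp : p.Guarded) (hk : p.maxReg ≤ k) (hc : CodeAt code b (p.compile b e)) :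
    Runs code k b σ e σ' := by
  induction h generalizing b e with
  | inc r σ =>
    simp only [Guarded, maxReg] at hp hk
    exact Runs.inc (hc 0 _ rfl) (by omega) hk
  | clear r σ =>
    simp only [Guarded, maxReg] at hp hk
    exact runs_clear (hc 0 _ rfl) (by omega) hk σ
  | @copy x t o σ ht =>
    simp only [Guarded, maxReg] at hp hk
    refine (runs_copy_forth (hc 0 _ rfl) (hc 1 _ rfl) (x := x) (t := t) (o := o) ?_ ?_ ?_ ?_ ?_ ?_
      ?_ ?_ ?_ σ).trans ?_
    any_goals omega
    convert runs_copy_back (hc 2 _ rfl) (x := x) (t := t) ?_ ?_ ?_ ?_ ?_ _ using 1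
    any_goals omega
    funext r
    simp only [Function.update_apply]
    grind
  | loop_zero h =>
    simp only [Guarded, maxReg] at hp hk
    exact Runs.zero hc.cons.1 (by omega) h
  | loop_succ h _ _ ih₁ ih₂ =>
    have hp' := hp
    have hk' := hk
    simp only [Guarded, maxReg] at hp hk
    refine (Runs.dec hc.cons.1 (by omega) (by omega) h).trans ?_
    exact (ih₁ hp.2 (by omega) hc.cons.2).trans (ih₂ hp' hk' hc)
  | @seq p q _ _ _ _ _ ih₁ ih₂ =>
    simp only [Guarded, maxReg] at hp hk
    obtain ⟨h₁, h₂⟩ := CodeAt.append hc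
    rw [length_compile] at h₂
    exact (ih₁ hp.1 (by omega) h₁).trans (ih₂ hp.2 (by omega) h₂)

end Prog

/-! ### The machine that searches with growing budgets -/

section Search

/-- The registers during the search: the input `n`, the flag `f`, and the next candidate `j`. -/
def searchRegs (n j f : ℕ) : ℕ → ℕ := fun r =>
  if r = 1 then n else if r = 3 then f else if r = 4 then j else 0

theorem regSum_searchRegs_start {k : ℕ} (hk : 1 ≤ k) (n : ℕ) : regSum k (searchRegs n 0 0) = n := by
  have h := regSum_update le_rfl hk (fun _ => 0) n
  have h0 : regSum k (fun _ => 0) = 0 := by simp [regSum]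
  have : searchRegs n 0 0 = Function.update (fun _ => 0) 1 n := by
    funext r
    simp [searchRegs, Function.update_apply]
  rw [this]
  omega

/-- A program that replaces the flag by `g n j`, and the candidate `j` by `j + 1`. -/
theorem exists_search_body {g : ℕ → ℕ → ℕ} (hg : Primrec₂ g) :
    ∃ p : Prog, p.Guarded ∧
      ∀ n j, Prog.Exec p (searchRegs n j 0) (searchRegs n (j + 1) (g n j)) := by
  have hf : Primrec fun v : List.Vector ℕ 2 => g (v.get 0) (v.get 1) :=
    hg.comp (Primrec.vector_get.comp Primrec.id (Primrec.const 0))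
      (Primrec.vector_get.comp Primrec.id (Primrec.const 1))
  obtain ⟨p, hp, h⟩ := Prog.exists_prog_of_primrec (Nat.Primrec'.of_prim hf) ![5, 4] 3 6
    (by decide) (by decide) (by decide)
  refine ⟨.seq (.copy 1 2 5) (.seq p (.seq (.clear 5) (.inc 4))), ?_, fun n j => ?_⟩
  · simp [Prog.Guarded, hp]
  · convert Prog.Exec.seq (Prog.Exec.copy (x := 1) (t := 2) (o := 5) ?_)
      (.seq (h _ (n ::ᵥ j ::ᵥ List.Vector.nil) ?_ ?_ ?_) (.seq (.clear 5 _) (.inc 4 _))) using 1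
    · have h1 : (n ::ᵥ j ::ᵥ List.Vector.nil).get 0 = n := rfl
      have h2 : (n ::ᵥ j ::ᵥ List.Vector.nil).get 1 = j := rfl
      rw [h1, h2]
      funext r
      simp only [bump, searchRegs, Function.update_apply]
      grind
    · simp [searchRegs]
    · intro i
      fin_cases i <;> simp [searchRegs]
      rfl
    · intro r hr
      simp only [searchRegs, Function.update_apply]
      grind
    · simp [searchRegs]

/-- The main program sets the flag, and repeats its body as long as the flag is set. The flag has
value at most `1`, so that it is zero whenever the body starts. -/
def searchProg (body : Prog) : Prog := .seq (.inc 3) (.loop 3 body)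

/-- The restart section. It clears the counters `2, …, k`, giving the content of the counter `2`
to the counter `1`, and the other contents to the counter `0`. Finally, it increases the budget
by a unit, and starts the main program at address `k`. -/
def restartCode (k : ℕ) : List Instr :=
  (List.range (k - 1)).map (fun i => .move (i + 2) (if i = 0 then 1 else 0) i (i + 1)) ++ [.grow k]

/-- The code of the search machine. -/
def searchCode (k : ℕ) (body : Prog) : List Instr :=
  restartCode k ++ (searchProg body).compile k (k + (searchProg body).size)

variable {k : ℕ} {body : Prog}

theorem length_restartCode (hk : 3 ≤ k) : (restartCode k).length = k := by
  simp only [restartCode, List.length_append, List.length_map, List.length_range,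
    List.length_singleton]
  omega

theorem length_searchCode (hk : 3 ≤ k) :
    (searchCode k body).length = k + (searchProg body).size := by
  rw [searchCode, List.length_append, length_restartCode hk, Prog.length_compile]

theorem codeAt_searchCode (hk : 3 ≤ k) :
    CodeAt (searchCode k body) k
      ((searchProg body).compile k (k + (searchProg body).size)) := by
  have := codeAt_append_append (restartCode k)
    ((searchProg body).compile k (k + (searchProg body).size)) []
  rwa [List.append_nil, length_restartCode hk] at this

theorem searchCode_restart {i : ℕ} (hi : i < k - 1) :
    (searchCode k body)[i]? = some (.move (i + 2) (if i = 0 then 1 else 0) i (i + 1)) := by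
  rw [searchCode, restartCode, List.append_assoc, List.getElem?_append_left (by simpa using hi)]
  simp [hi]

theorem searchCode_grow : (searchCode k body)[k - 1]? = some (.grow k) := by
  rw [searchCode, restartCode, List.append_assoc, List.getElem?_append_right (by simp)]
  simp

theorem three_le_of_maxReg_le (h : (searchProg body).maxReg ≤ k) : 3 ≤ k := by
  simp only [searchProg, Prog.maxReg] at h
  omega

theorem guarded_searchProg (hb : body.Guarded) : (searchProg body).Guarded :=
  ⟨le_rfl, le_rfl, hb⟩

/-- Classification of the instructions of the search machine. -/
theorem searchCode_cases (hb : body.Guarded) (hk : (searchProg body).maxReg ≤ k) {s : ℕ}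
    {ins : Instr} (h : (searchCode k body)[s]? = some ins) :
    (s < k - 1 ∧ ins = .move (s + 2) (if s = 0 then 1 else 0) s (s + 1)) ∨
      (s = k - 1 ∧ ins = .grow k) ∨
      (k ≤ s ∧ ∃ c d j₁ j₂, ins = .move c d j₁ j₂ ∧ c ≤ k ∧ d ≤ k ∧
        ((c = 1 ∨ c = 2) ↔ (d = 1 ∨ d = 2)) ∧
        (j₁ = 0 ∨ (k ≤ j₁ ∧ j₁ ≤ (searchCode k body).length)) ∧
        (j₂ = 0 ∨ (k ≤ j₂ ∧ j₂ ≤ (searchCode k body).length))) := by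
  have hk3 := three_le_of_maxReg_le hk
  rcases Nat.lt_or_ge s (k - 1) with hs | hs
  · rw [searchCode_restart hs] at h
    exact .inl ⟨hs, (Option.some.inj h).symm⟩
  rcases Nat.eq_or_lt_of_le hs with hs | hs
  · rw [← hs, searchCode_grow] at h
    exact .inr (.inl ⟨hs.symm, (Option.some.inj h).symm⟩)
  · refine .inr (.inr ⟨by omega, ?_⟩)
    rw [searchCode, List.getElem?_append_right (by rw [length_restartCode hk3]; omega)] at h
    obtain ⟨c, d, j₁, j₂, h, h'⟩ :=
      Prog.compile_spec (guarded_searchProg hb) (List.mem_of_getElem? h)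
    refine ⟨c, d, j₁, j₂, h, ?_⟩
    rw [length_searchCode hk3]
    omega

theorem bounded_searchCode (hb : body.Guarded) (hk : (searchProg body).maxReg ≤ k) :
    ∀ ins ∈ searchCode k body, ins.Bounded k (searchCode k body).length := by
  intro ins h
  have hk3 := three_le_of_maxReg_le hk
  obtain ⟨s, hs⟩ := List.getElem?_of_mem h
  have hl := length_searchCode (body := body) hk3
  rcases searchCode_cases hb hk hs with ⟨h, rfl⟩ | ⟨h, rfl⟩ | ⟨h, c, d, j₁, j₂, rfl, h'⟩
  · simp only [Instr.Bounded]
    split_ifs <;> omega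
  · simp only [Instr.Bounded]
    omega
  · simp only [Instr.Bounded]
    omega

/-- The initial state for input `n` and total budget `T`, which includes the input. -/
def startState (k n T : ℕ) : CounterState := (k, withBudget k T (searchRegs n 0 0))

section Runs

variable {g : ℕ → ℕ → ℕ}

theorem runs_search_start (hk : (searchProg body).maxReg ≤ k) (n : ℕ) :
    Runs (searchCode k body) k k (searchRegs n 0 0) (k + 1) (searchRegs n 0 1) := by
  have hk3 := three_le_of_maxReg_le hk
  have hc := (codeAt_searchCode (body := body) hk3).append.1.cons.1
  have h := Runs.inc hc (by omega) hk3 (σ := searchRegs n 0 0)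
  have heq : bump 3 (searchRegs n 0 0) = searchRegs n 0 1 := by
    funext r
    simp only [bump, searchRegs, Function.update_apply]
    grind
  rw [heq] at h
  exact h

theorem runs_search_step (hb : body.Guarded) (hk : (searchProg body).maxReg ≤ k)
    (hbody : ∀ n j, Prog.Exec body (searchRegs n j 0) (searchRegs n (j + 1) (g n j))) (n j : ℕ) :
    Runs (searchCode k body) k (k + 1) (searchRegs n j 1) (k + 1)
      (searchRegs n (j + 1) (g n j)) := by
  have hk3 := three_le_of_maxReg_le hk
  have hc := (codeAt_searchCode (body := body) hk3).append.2.cons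
  have hbk : body.maxReg ≤ k := by
    simp only [searchProg, Prog.maxReg] at hk
    omega
  have h := Runs.dec (n := 0) hc.1 (by omega) hk3 (σ := searchRegs n j 1) (by simp [searchRegs])
  have heq : Function.update (searchRegs n j 1) 3 0 = searchRegs n j 0 := by
    funext r
    simp only [searchRegs, Function.update_apply]
    grind
  rw [heq] at h
  exact h.trans ((hbody n j).runs hb hbk hc.2)

theorem runs_search_loop (hb : body.Guarded) (hk : (searchProg body).maxReg ≤ k)
    (hbody : ∀ n j, Prog.Exec body (searchRegs n j 0) (searchRegs n (j + 1) (g n j))) {n j : ℕ}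
    (hj : ∀ i < j, g n i = 1) :
    Runs (searchCode k body) k k (searchRegs n 0 0) (k + 1) (searchRegs n j 1) := by
  induction j with
  | zero => exact runs_search_start hk n
  | succ j ih =>
    have := runs_search_step hb hk hbody n j
    rw [hj j (Nat.lt_succ_self j)] at this
    exact (ih fun i hi => hj i (by omega)).trans this

/-- If the search succeeds, then with a large enough budget, the machine halts. -/
theorem exists_budget_of_search_succeeds (hb : body.Guarded) (hk : (searchProg body).maxReg ≤ k)
    (hbody : ∀ n j, Prog.Exec body (searchRegs n j 0) (searchRegs n (j + 1) (g n j)))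
    (hg : ∀ n j, g n j ≤ 1) {n j : ℕ} (hj : g n j = 0) :
    ∃ B, ∀ T, B ≤ T → n ≤ T → ∃ v, counterSum k v = T ∧
      PerfectReach (searchCode k body) (startState k n T) ((searchCode k body).length, v) := by
  have hk3 := three_le_of_maxReg_le hk
  classical
  have hex : ∃ j, g n j = 0 := ⟨j, hj⟩
  have h₁ := runs_search_loop hb hk hbody (n := n) (j := Nat.find hex) fun i hi => by
    have := Nat.find_min hex hi
    have := hg n i
    omega
  have h₂ := runs_search_step hb hk hbody n (Nat.find hex)
  rw [Nat.find_spec hex] at h₂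
  have hc := (codeAt_searchCode (body := body) hk3).append.2.cons.1
  have h₃ := Runs.zero (k := k) hc (by omega)
    (σ := searchRegs n (Nat.find hex + 1) 0) (by simp [searchRegs])
  obtain ⟨B, h⟩ := (h₁.trans h₂).trans h₃
  refine ⟨B, fun T hB hT => ?_⟩
  rcases h T (by rwa [regSum_searchRegs_start (by omega)]) with ⟨hT', h⟩ | ⟨hB', -⟩
  · refine ⟨_, counterSum_withBudget hT', ?_⟩
    rw [length_searchCode hk3]
    exact h
  · omega

/-- If the search does not succeed, then the budget is exhausted, and the machine aborts. -/
theorem exists_abort_of_search_fails (hb : body.Guarded) (hk : (searchProg body).maxReg ≤ k)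
    (hbody : ∀ n j, Prog.Exec body (searchRegs n j 0) (searchRegs n (j + 1) (g n j))) {n : ℕ}
    (hn : ∀ j, g n j = 1) {T : ℕ} (hT : n ≤ T) (hk4 : 4 ≤ k) :
    ∃ v, PerfectReach (searchCode k body) (startState k n T) (0, v) := by
  -- After `T + 1` iterations, the candidate would exceed the budget.
  obtain ⟨B, h⟩ := runs_search_loop hb hk hbody (n := n) (j := T + 1) fun i _ => hn i
  rcases h T (by rwa [regSum_searchRegs_start (by omega)]) with ⟨hT', -⟩ | ⟨-, h⟩
  · have := le_regSum (c := 4) (by omega) hk4 (searchRegs n (T + 1) 1)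
    have h4 : searchRegs n (T + 1) 1 4 = T + 1 := by simp [searchRegs]
    omega
  · exact h

end Runs

/-! ### Invariants of the search machine -/

section Invariants

/-- The counters beyond `k` are zero. -/
def SupportedBy (k : ℕ) (v : ℕ → ℕ) : Prop := ∀ r, k < r → v r = 0

theorem SupportedBy.update {v : ℕ → ℕ} (h : SupportedBy k v) {c : ℕ} (hc : c ≤ k) (n : ℕ) :
    SupportedBy k (Function.update v c n) := fun r hr => by
  rw [Function.update_of_ne (by omega), h r hr]

theorem SupportedBy.bump {v : ℕ → ℕ} (h : SupportedBy k v) {c : ℕ} (hc : c ≤ k) :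
    SupportedBy k (bump c v) :=
  h.update hc _

/-- In the restart section, the counters that precede the current one have been cleared. -/
def ClearedBefore (k s : ℕ) (v : ℕ → ℕ) : Prop := s < k → ∀ r, 2 ≤ r → r < s + 2 → v r = 0

theorem counterSum_move {c d n : ℕ} (hc : c ≤ k) (hd : d ≤ k) {v : ℕ → ℕ} (hv : v c = n + 1) :
    counterSum k (bump d (Function.update v c n)) = counterSum k v := by
  have h₁ := counterSum_update hc v n
  have h₂ := counterSum_bump hd (Function.update v c n)
  omega

theorem input_move {c d n : ℕ} (hcd : (c = 1 ∨ c = 2) ↔ (d = 1 ∨ d = 2)) {v : ℕ → ℕ}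
    (hv : v c = n + 1) :
    bump d (Function.update v c n) 1 + bump d (Function.update v c n) 2 = v 1 + v 2 := by
  simp only [bump, Function.update_apply]
  grind

theorem LossyStep.supportedBy
    (hwf : ∀ ins ∈ searchCode k body, ins.Bounded k (searchCode k body).length)
    {s s' : ℕ} {v v' : ℕ → ℕ} (h : LossyStep (searchCode k body) (s, v) (s', v'))
    (hv : SupportedBy k v) : SupportedBy k v' := by
  cases h with
  | move h hc =>
    obtain ⟨hck, hdk, -⟩ := hwf _ (List.mem_of_getElem? h)
    exact (hv.update hck _).bump hdk
  | reset h => exact hv.update (hwf _ (List.mem_of_getElem? h)).1 _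
  | grow h => exact hv.bump (Nat.zero_le k)

/-- The move instructions of the search machine conserve the sum of the counters `1` and `2`, and
do not enter the restart section except at its first instruction. -/
theorem searchCode_move (hb : body.Guarded) (hk : (searchProg body).maxReg ≤ k) {s c d j₁ j₂ : ℕ}
    (h : (searchCode k body)[s]? = some (.move c d j₁ j₂)) :
    c ≤ k ∧ d ≤ k ∧ ((c = 1 ∨ c = 2) ↔ (d = 1 ∨ d = 2)) ∧
      ((j₁ = s ∧ d ≤ 1 ∧ c = s + 2 ∧ j₂ = s + 1 ∧ s < k) ∨
        (j₁ = 0 ∨ k ≤ j₁) ∧ (j₂ = 0 ∨ k ≤ j₂)) := by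
  rcases searchCode_cases hb hk h with ⟨hs, h'⟩ | ⟨hs, h'⟩ | ⟨hs, c', d', i₁, i₂, h', h''⟩
  · cases h'
    have := three_le_of_maxReg_le hk
    split_ifs <;> exact ⟨by omega, by omega, by grind, .inl (by omega)⟩
  · cases h'
  · cases h'
    omega

theorem LossyStep.clearedBefore (hb : body.Guarded) (hk : (searchProg body).maxReg ≤ k)
    {s s' : ℕ} {v v' : ℕ → ℕ} (h : LossyStep (searchCode k body) (s, v) (s', v'))
    (hv : ClearedBefore k s v) : ClearedBefore k s' v' := by
  cases h with
  | move h hc =>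
    obtain ⟨-, -, -, ⟨rfl, hd, rfl, rfl, hs⟩ | ⟨h, -⟩⟩ := searchCode_move hb hk h
    · intro hs' r hr hr'
      have := hv hs' r hr hr'
      rw [bump, Function.update_of_ne (by omega), Function.update_of_ne (by omega), this]
    · intro hs' r hr hr'
      omega
  | reset h =>
    obtain ⟨-, -, -, ⟨rfl, hd, rfl, rfl, hs⟩ | ⟨-, h⟩⟩ := searchCode_move hb hk h
    · intro hs' r hr hr'
      rw [Function.update_apply]
      split_ifs with h
      · rfl
      · exact hv hs r hr (by omega)
    · intro hs' r hr hr'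
      omega
  | grow h =>
    rcases searchCode_cases hb hk h with ⟨hs, h'⟩ | ⟨hs, h'⟩ | ⟨hs, c', d', i₁, i₂, h', h''⟩
    · cases h'
    · cases h'
      exact fun hs' => absurd hs' (lt_irrefl _)
    · cases h'

/-- A lossy step is a conservative step of the intended semantics, or loses units, or increases
the budget at the end of the restart section. -/
theorem LossyStep.perfect_or_loses (hb : body.Guarded) (hk : (searchProg body).maxReg ≤ k)
    {s s' : ℕ} {v v' : ℕ → ℕ} (h : LossyStep (searchCode k body) (s, v) (s', v')) :
    (PerfectStep (searchCode k body) (s, v) (s', v') ∧ v' 1 + v' 2 = v 1 + v 2 ∧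
        counterSum k v' = counterSum k v) ∨
      v' 1 + v' 2 < v 1 + v 2 ∨
      (v' 1 + v' 2 = v 1 + v 2 ∧ counterSum k v' < counterSum k v) ∨
      (s = k - 1 ∧ s' = k ∧ v' = bump 0 v) := by
  cases h with
  | move h hc =>
    obtain ⟨hck, hdk, hcd, -⟩ := searchCode_move hb hk h
    refine .inl ⟨?_, input_move hcd hc, counterSum_move hck hdk hc⟩
    simp [PerfectStep, perfectNext, h, hc]
  | @reset _ c d j₁ j₂ _ h =>
    obtain ⟨hck, hdk, hcd, -⟩ := searchCode_move hb hk h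
    by_cases hc : v c = 0
    · have : Function.update v c 0 = v := by rw [← hc, Function.update_eq_self]
      rw [this]
      exact .inl ⟨by simp [PerfectStep, perfectNext, h, hc], rfl, rfl⟩
    · have hsum := counterSum_update hck v 0
      refine .inr ?_
      simp only [Function.update_apply]
      grind
  | grow h =>
    rcases searchCode_cases hb hk h with ⟨hs, h'⟩ | ⟨hs, h'⟩ | ⟨hs, c', d', i₁, i₂, h', h''⟩
    · cases h'
    · cases h'
      exact .inr (.inr (.inr ⟨hs, rfl, rfl⟩))
    · cases h'

/-- The intended semantics conserves the input, and never decreases the sum of the counters. -/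
theorem PerfectStep.conserves (hb : body.Guarded) (hk : (searchProg body).maxReg ≤ k)
    {x y : CounterState} (h : PerfectStep (searchCode k body) x y) :
    y.2 1 + y.2 2 = x.2 1 + x.2 2 ∧ counterSum k x.2 ≤ counterSum k y.2 := by
  obtain ⟨s, v⟩ := x
  unfold PerfectStep perfectNext at h
  split at h
  · rename_i c d j₁ j₂ hs
    obtain ⟨hck, hdk, hcd, -⟩ := searchCode_move hb hk hs
    split_ifs at h with hc <;> cases h
    · exact ⟨rfl, le_rfl⟩
    · have hv := (Nat.succ_pred_eq_of_ne_zero hc).symm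
      exact ⟨input_move hcd hv, (counterSum_move hck hdk hv).ge⟩
  · cases h
    refine ⟨?_, by rw [counterSum_bump (Nat.zero_le k)]; omega⟩
    simp [bump]
  · exact absurd h (by simp)

theorem PerfectReach.conserves (hb : body.Guarded) (hk : (searchProg body).maxReg ≤ k)
    {x y : CounterState} (h : PerfectReach (searchCode k body) x y) :
    y.2 1 + y.2 2 = x.2 1 + x.2 2 ∧ counterSum k x.2 ≤ counterSum k y.2 := by
  induction h with
  | refl => exact ⟨rfl, le_rfl⟩
  | tail _ hs ih =>
    have := PerfectStep.conserves hb hk hs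
    exact ⟨this.1.trans ih.1, ih.2.trans this.2⟩

theorem PerfectReach.supportedBy (hb : body.Guarded) (hk : (searchProg body).maxReg ≤ k)
    {x y : CounterState} (h : PerfectReach (searchCode k body) x y) (hx : SupportedBy k x.2) :
    SupportedBy k y.2 := by
  induction h with
  | refl => exact hx
  | tail _ hs ih => exact LossyStep.supportedBy (bounded_searchCode hb hk) hs.lossyStep ih

theorem supportedBy_startState (hk : 4 ≤ k) (n T : ℕ) : SupportedBy k (startState k n T).2 := by
  intro r hr
  simp only [startState, withBudget, searchRegs, Function.update_apply]
  grind

theorem startState_input (n T : ℕ) :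
    (startState k n T).2 1 = n ∧ (startState k n T).2 2 = 0 := by
  simp [startState, withBudget, searchRegs]

theorem counterSum_startState (hk : 1 ≤ k) {n T : ℕ} (h : n ≤ T) :
    counterSum k (startState k n T).2 = T :=
  counterSum_withBudget (by rwa [regSum_searchRegs_start hk])

/-- Counters that contain only the input and the budget are those of an initial state. -/
theorem eq_startState (hk : 4 ≤ k) {v : ℕ → ℕ} (hs : SupportedBy k v)
    (h : ∀ r, 2 ≤ r → r ≤ k → v r = 0) : (k, v) = startState k (v 1) (counterSum k v) := by
  have hreg : regSum k v = v 1 := by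
    rw [← regSum_searchRegs_start (k := k) (by omega) (v 1)]
    refine Finset.sum_congr rfl fun i hi => ?_
    have := Finset.mem_range.1 hi
    simp only [searchRegs]
    by_cases hi0 : i = 0
    · simp [hi0]
    · rw [h (i + 1) (by omega) (by omega)]
      grind
  have hsum := counterSum_eq k v
  simp only [startState, Prod.mk.injEq, true_and]
  funext r
  simp only [withBudget, regSum_searchRegs_start (k := k) (by omega), Function.update_apply,
    searchRegs]
  by_cases h0 : r = 0
  · subst h0
    rw [if_pos rfl]
    omega
  · rw [if_neg h0]
    by_cases h1 : r = 1
    · rw [if_pos h1, h1]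
    · have : v r = 0 := by
        by_cases hrk : r ≤ k
        · exact h r (by omega) hrk
        · exact hs r (by omega)
      rw [this]
      grind

/-! ### Growth of the budget when the search fails -/

theorem reach_clear_counter {i : ℕ} (hi : i < k - 1) (v : ℕ → ℕ) :
    ∃ v', PerfectReach (searchCode k body) (i, v) (i + 1, v') ∧
      ∀ r, 2 ≤ r → v' r = if r = i + 2 then 0 else v r := by
  have hc := searchCode_restart (body := body) hi
  generalize hn : v (i + 2) = n
  induction n generalizing v with
  | zero =>
    refine ⟨v, .single (by simp [PerfectStep, perfectNext, hc, hn]), fun r _ => ?_⟩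
    split_ifs with h
    · rw [h, hn]
    · rfl
  | succ n ih =>
    obtain ⟨v', hv', h⟩ := ih
      (bump (if i = 0 then 1 else 0) (Function.update v (i + 2) n)) (by
        simp only [bump, Function.update_apply]
        grind)
    refine ⟨v', .head (by simp [PerfectStep, perfectNext, hc, hn]) hv', fun r hr => ?_⟩
    rw [h r hr]
    simp only [bump, Function.update_apply]
    grind

theorem reach_restart {i : ℕ} (hi : i ≤ k - 1) (v : ℕ → ℕ) :
    ∃ v', PerfectReach (searchCode k body) (0, v) (i, v') ∧
      ∀ r, 2 ≤ r → r < i + 2 → v' r = 0 := by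
  induction i with
  | zero => exact ⟨v, .refl, fun r hr hr' => by omega⟩
  | succ i ih =>
    obtain ⟨v', hv', h⟩ := ih (by omega)
    obtain ⟨v'', hv'', h'⟩ := reach_clear_counter (k := k) (body := body) (i := i) (by omega) v'
    refine ⟨v'', hv'.trans hv'', fun r hr hr' => ?_⟩
    rw [h' r hr]
    split_ifs with hri
    · rfl
    · exact h r hr (by omega)

/-- If the search does not succeed, then the machine restarts with arbitrarily large budgets. -/
theorem reach_large_budget {g : ℕ → ℕ → ℕ} (hb : body.Guarded)
    (hk : (searchProg body).maxReg ≤ k) (hk4 : 4 ≤ k)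
    (hbody : ∀ n j, Prog.Exec body (searchRegs n j 0) (searchRegs n (j + 1) (g n j))) {n : ℕ}
    (hn : ∀ j, g n j = 1) (T : ℕ) :
    ∃ T', n + T ≤ T' ∧
      PerfectReach (searchCode k body) (startState k n n) (startState k n T') := by
  induction T with
  | zero => exact ⟨n, le_rfl, .refl⟩
  | succ T ih =>
    obtain ⟨T', hT', h⟩ := ih
    obtain ⟨v, hv⟩ := exists_abort_of_search_fails hb hk hbody hn (T := T') (by omega) hk4
    obtain ⟨v', hv', hclear⟩ := reach_restart (body := body) (i := k - 1) le_rfl v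
    have hgrow : PerfectStep (searchCode k body) (k - 1, v') (k, bump 0 v') := by
      simp [PerfectStep, perfectNext, searchCode_grow]
    have hreach : PerfectReach (searchCode k body) (startState k n T') (k, bump 0 v') :=
      (hv.trans hv').tail hgrow
    have hcons := PerfectReach.conserves hb hk (hv.trans hv')
    have hsupp := PerfectReach.supportedBy hb hk hreach (supportedBy_startState hk4 n T')
    have hin := startState_input (k := k) n T'
    have hsum := counterSum_startState (k := k) (by omega) (n := n) (T := T') (by omega)
    have h2 : v' 2 = 0 := hclear 2 le_rfl (by omega)
    have heq := eq_startState (v := bump 0 v') hk4 hsupp fun r hr hrk => by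
      rw [bump, Function.update_of_ne (by omega)]
      exact hclear r hr (by omega)
    have hb1 : bump 0 v' 1 = n := by
      have : bump 0 v' 1 = v' 1 := Function.update_of_ne (by omega) _ _
      have := hcons.1
      dsimp only at this
      omega
    have hbs : counterSum k (bump 0 v') = counterSum k v' + 1 := counterSum_bump (Nat.zero_le k) _
    rw [hb1] at heq
    refine ⟨counterSum k (bump 0 v'), ?_, ?_⟩
    · have := hcons.2
      dsimp only at this
      omega
    · rw [← heq]
      exact h.trans hreach

/-! ### Boundedness of the budget when the search succeeds -/

theorem PerfectStep.reach_of_reach_halting {code : List Instr} {x y : CounterState} {v : ℕ → ℕ}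
    (hxy : PerfectStep code x y) (h : PerfectReach code x (code.length, v)) :
    PerfectReach code y (code.length, v) := by
  rcases Relation.ReflTransGen.cases_head h with rfl | ⟨z, hz, h⟩
  · simp [PerfectStep, perfectNext] at hxy
  · have : y = z := Option.some.inj (hxy.symm.trans hz)
    exact this ▸ h

/-- The invariant of lossy runs with input at most `n`, for a bound `W` on the number of units:
units of the input have been lost, or less than `W` units are present, or `W` units are present
and the intended run from `x` halts without an increase of this number. -/
def LossyInvariant (code : List Instr) (k n W : ℕ) (x : CounterState) : Prop :=
  SupportedBy k x.2 ∧ ClearedBefore k x.1 x.2 ∧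
    (x.2 1 + x.2 2 < n ∨ (x.2 1 + x.2 2 = n ∧ (counterSum k x.2 < W ∨
      (counterSum k x.2 = W ∧ ∃ v, counterSum k v = W ∧ PerfectReach code x (code.length, v)))))

/-- A wrong zero test makes one of the first two conditions of the invariant true, and a restart
adds a unit only if less than `W` units are present; it reaches `W` units only in the initial
state for the intact input. -/
theorem LossyInvariant.step (hb : body.Guarded) (hk : (searchProg body).maxReg ≤ k) (hk4 : 4 ≤ k)
    {n W : ℕ} (hW : ∃ v, counterSum k v = W ∧
      PerfectReach (searchCode k body) (startState k n W) ((searchCode k body).length, v))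
    {x y : CounterState} (hx : LossyInvariant (searchCode k body) k n W x)
    (h : LossyStep (searchCode k body) x y) : LossyInvariant (searchCode k body) k n W y := by
  obtain ⟨s, v⟩ := x
  obtain ⟨s', v'⟩ := y
  obtain ⟨hs, hcl, hinv⟩ := hx
  have hs' := h.supportedBy (bounded_searchCode hb hk) hs
  refine ⟨hs', h.clearedBefore hb hk hcl, ?_⟩
  dsimp only at hs hcl hinv hs' ⊢
  rcases h.perfect_or_loses hb hk with ⟨hp, hin, hsum⟩ | hin | ⟨hin, hsum⟩ | ⟨rfl, rfl, rfl⟩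
  · rw [hin, hsum]
    rcases hinv with hinv | ⟨hinv, hlt | ⟨heq, v₁, hv₁, hr⟩⟩
    · exact .inl hinv
    · exact .inr ⟨hinv, .inl hlt⟩
    · exact .inr ⟨hinv, .inr ⟨heq, v₁, hv₁, hp.reach_of_reach_halting hr⟩⟩
  · exact .inl (by omega)
  · rcases hinv with hinv | ⟨hinv, h⟩
    · exact .inl (by omega)
    · exact .inr ⟨by omega, .inl (by omega)⟩
  · have hsum := counterSum_bump (Nat.zero_le s') v
    have h1 : bump 0 v 1 = v 1 := Function.update_of_ne (by omega) _ _
    have h2 : bump 0 v 2 = v 2 := Function.update_of_ne (by omega) _ _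
    have hv2 : v 2 = 0 := hcl (by omega) 2 le_rfl (by omega)
    rw [h1, h2, hsum]
    rcases hinv with hinv | ⟨hinv, hlt | ⟨heq, v₁, hv₁, hr⟩⟩
    · exact .inl hinv
    · refine .inr ⟨hinv, ?_⟩
      rcases Nat.lt_or_eq_of_le (Nat.succ_le_of_lt hlt) with hlt | heq
      · exact .inl hlt
      · -- The restart has produced the initial state with budget `W`.
        refine .inr ⟨heq, ?_⟩
        have hst := eq_startState (v := bump 0 v) hk4 hs' fun r hr hrk => by
          rw [bump, Function.update_of_ne (by omega)]
          exact hcl (by omega) r hr (by omega)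
        rw [hsum, h1, show v 1 = n by omega, show counterSum s' v + 1 = W from heq] at hst
        rw [hst]
        exact hW
    · -- The intended run does not increase the sum of the counters, so it does not restart.
      have hp : PerfectStep (searchCode s' body) (s' - 1, v) (s', bump 0 v) := by
        simp [PerfectStep, perfectNext, searchCode_grow]
      have := (PerfectReach.conserves hb hk (hp.reach_of_reach_halting hr)).2
      dsimp only at this
      omega

/-- If the search succeeds, then as long as no unit of the input is lost, the sum of the counters
stays bounded on all lossy runs. -/
theorem exists_bound_of_search_succeeds {g : ℕ → ℕ → ℕ} (hb : body.Guarded)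
    (hk : (searchProg body).maxReg ≤ k) (hk4 : 4 ≤ k)
    (hbody : ∀ n j, Prog.Exec body (searchRegs n j 0) (searchRegs n (j + 1) (g n j)))
    (hg : ∀ n j, g n j ≤ 1) {n j : ℕ} (hj : g n j = 0) :
    ∃ W, ∀ n' ≤ n, ∀ y, Relation.ReflTransGen (LossyStep (searchCode k body))
      (startState k n' n') y → n ≤ y.2 1 → counterSum k y.2 ≤ W := by
  obtain ⟨B, hB⟩ := exists_budget_of_search_succeeds hb hk hbody hg hj
  refine ⟨max B (n + 1), fun n' hn' y hy hny => ?_⟩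
  have hW := hB (max B (n + 1)) (le_max_left _ _) (by omega)
  have hinv : LossyInvariant (searchCode k body) k n (max B (n + 1)) y := by
    clear hny
    induction hy with
    | refl =>
      have hin := startState_input (k := k) n' n'
      have hsum := counterSum_startState (k := k) (by omega) (le_refl n')
      refine ⟨supportedBy_startState hk4 _ _, fun h => absurd h (lt_irrefl _), ?_⟩
      omega
    | tail _ hs ih =>
      exact ih.step hb hk hk4 hW hs
  obtain ⟨-, -, h⟩ := hinv
  omega

end Invariants

end Search

/-! ### The clover of the search system -/

section Clover

open CounterSim

/-- The symbolic state for input `n` and an empty counter `0`. -/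
def inputSymb (k l n : ℕ) : SymbConfig (3 * (l + 1)) (k + 1) 2 :=
  (ctl l 0 k, fun i => if i = chn k 1 then List.replicate n (Sum.inl 0) else [])

/-- The symbolic state for input `n` and an unbounded counter `0`. -/
def unboundedSymb (k l n : ℕ) : SymbConfig (3 * (l + 1)) (k + 1) 2 :=
  (ctl l 0 k, fun i => if i = chn k 1 then List.replicate n (Sum.inl 0)
    else if i = chn k 0 then [Sum.inr fun a => decide (a = 0)] else [])

theorem mem_productLang_replicate {n : ℕ} {w : List (Fin 2)} :
    w ∈ productLang (List.replicate n (Sum.inl 0)) ↔ ∃ j ≤ n, w = List.replicate j 0 := by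
  induction n generalizing w with
  | zero => simp [productLang]
  | succ n ih =>
    constructor
    · rintro ⟨u, hu, v, hv, rfl⟩
      obtain ⟨j, hj, rfl⟩ := ih.1 hv
      rcases hu with rfl | rfl
      · exact ⟨j, by omega, rfl⟩
      · exact ⟨j + 1, by omega, rfl⟩
    · rintro ⟨j, hj, rfl⟩
      rcases j with _ | j
      · exact nil_mem_productLang _
      · exact ⟨[0], .inr rfl, _, ih.2 ⟨j, by omega, rfl⟩, rfl⟩

theorem mem_productLang_zero_star {w : List (Fin 2)} :
    w ∈ productLang [Sum.inr fun a => decide (a = 0)] ↔ ∃ j, w = List.replicate j 0 := by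
  constructor
  · rintro ⟨u, hu, v, rfl, rfl⟩
    refine ⟨u.length, ?_⟩
    rw [List.append_nil]
    exact List.eq_replicate_iff.2 ⟨rfl, fun b hb => by simpa using hu b hb⟩
  · rintro ⟨j, rfl⟩
    refine ⟨_, fun b hb => ?_, [], rfl, (List.append_nil _).symm⟩
    simp [List.eq_of_mem_replicate hb]

theorem chn_ne {k c d : ℕ} (hc : c ≤ k) (hd : d ≤ k) (h : c ≠ d) : chn k c ≠ chn k d := fun he => by
  have := congrArg Fin.val he
  rw [val_chn hc, val_chn hd] at this
  exact h this

/-- By losses of the input, the elements of the ideal include the initial states for smaller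
inputs. -/
theorem mem_inputSymb {k l n : ℕ} (hk : 1 ≤ k) {s : Config (3 * (l + 1)) (k + 1) 2} :
    s ∈ (inputSymb k l n).toIdeal ↔ ∃ j ≤ n, s = encConfig k l (startState k j j) := by
  have hval : ∀ j (i : Fin (k + 1)), (startState k j j).2 i = if i = chn k 1 then j else 0 := by
    intro j i
    have h1 := val_chn hk
    have hi : i = chn k 1 ↔ (i : ℕ) = 1 := by rw [Fin.ext_iff, h1]
    simp only [startState, withBudget, regSum_searchRegs_start hk, Function.update_apply,
      searchRegs, hi]
    grind
  constructor
  · rintro ⟨hs, h⟩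
    have h1 := h (chn k 1)
    simp only [inputSymb, if_true] at h1
    obtain ⟨j, hj, hj'⟩ := mem_productLang_replicate.1 h1
    refine ⟨j, hj, Config.ext hs (funext fun i => ?_)⟩
    simp only [encConfig, chans, hval]
    by_cases hi : i = chn k 1
    · rw [if_pos hi, hi, hj']
    · have hi' := h i
      simp only [inputSymb, if_neg hi] at hi'
      rw [if_neg hi]
      exact hi'
  · rintro ⟨j, hj, rfl⟩
    refine ⟨rfl, fun i => ?_⟩
    simp only [encConfig, chans, hval, inputSymb]
    by_cases hi : i = chn k 1
    · rw [if_pos hi, if_pos hi]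
      exact mem_productLang_replicate.2 ⟨j, hj, rfl⟩
    · rw [if_neg hi, if_neg hi]
      rfl

theorem encConfig_mem_unboundedSymb {k l n p : ℕ} (hk : 4 ≤ k) :
    encConfig k l (startState k n (n + p)) ∈ (unboundedSymb k l n).toIdeal := by
  refine ⟨rfl, fun i => ?_⟩
  have h1 := val_chn (k := k) (c := 1) (by omega)
  have h0 := val_chn (k := k) (c := 0) (by omega)
  have hi1 : i = chn k 1 ↔ (i : ℕ) = 1 := by rw [Fin.ext_iff, h1]
  have hi0 : i = chn k 0 ↔ (i : ℕ) = 0 := by rw [Fin.ext_iff, h0]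
  simp only [encConfig, chans, unboundedSymb, startState, withBudget,
    regSum_searchRegs_start (k := k) (by omega), Function.update_apply, searchRegs, hi1, hi0]
  by_cases h : (i : ℕ) = 1
  · simp only [h, if_true, Nat.one_ne_zero, if_false]
    exact mem_productLang_replicate.2 ⟨n, le_rfl, rfl⟩
  · by_cases h' : (i : ℕ) = 0
    · simp only [h', if_true, if_false, Nat.zero_ne_one]
      exact mem_productLang_zero_star.2 ⟨_, rfl⟩
    · simp only [h, h', if_false, ite_self, List.replicate_zero]
      rfl

theorem exists_le_of_mem_unboundedSymb {k l n : ℕ} (hk : 4 ≤ k)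
    {s : Config (3 * (l + 1)) (k + 1) 2} (hs : s ∈ (unboundedSymb k l n).toIdeal) :
    ∃ p, ∀ T, n + p ≤ T → s ≤ encConfig k l (startState k n T) := by
  obtain ⟨hs, h⟩ := hs
  have h01 : chn k 0 ≠ chn k 1 := chn_ne (by omega) (by omega) (by omega)
  have h1 := h (chn k 1)
  have h0 := h (chn k 0)
  simp only [unboundedSymb, if_true, if_neg h01] at h0 h1
  obtain ⟨j, hj, hj'⟩ := mem_productLang_replicate.1 h1
  obtain ⟨p, hp⟩ := mem_productLang_zero_star.1 h0
  refine ⟨p, fun T hT => ⟨hs, fun i => ?_⟩⟩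
  show (s.channels i).Sublist (List.replicate ((startState k n T).2 i) 0)
  by_cases hi1 : i = chn k 1
  · rw [hi1, hj', val_chn (by omega), (startState_input n T).1]
    exact (List.replicate_sublist_replicate _).2 hj
  by_cases hi0 : i = chn k 0
  · rw [hi0, hp, val_chn (by omega)]
    refine (List.replicate_sublist_replicate _).2 ?_
    simp only [startState, withBudget_zero, regSum_searchRegs_start (k := k) (by omega)]
    omega
  · have hi := h i
    simp only [unboundedSymb, if_neg hi1, if_neg hi0] at hi
    have : s.channels i = [] := hi
    rw [this]
    exact List.nil_sublist _

/-- The state for input `n` with an unbounded budget belongs to the cover of the state for input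
`n` if and only if the search fails. -/
theorem unboundedSymb_subset_cover_iff {k : ℕ} {body : Prog} {g : ℕ → ℕ → ℕ} (hb : body.Guarded)
    (hk : (searchProg body).maxReg ≤ k) (hk4 : 4 ≤ k)
    (hbody : ∀ n j, Prog.Exec body (searchRegs n j 0) (searchRegs n (j + 1) (g n j)))
    (hg : ∀ n j, g n j ≤ 1) (n : ℕ) :
    ((unboundedSymb k (searchCode k body).length n).toIdeal : Set _) ⊆
        (toFLCS k (searchCode k body)).toFunctionalTS.coverOfIdeal
          (inputSymb k (searchCode k body).length n).toIdeal ↔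
      ∀ j, g n j ≠ 0 := by
  have hwf := bounded_searchCode hb hk
  have hkl : k ≤ (searchCode k body).length := by
    rw [length_searchCode (by omega)]
    omega
  constructor
  · intro h j hj
    obtain ⟨W, hW⟩ := exists_bound_of_search_succeeds hb hk hk4 hbody hg hj
    obtain ⟨y, hy, z, hyz, hle⟩ := h (encConfig_mem_unboundedSymb (p := W + 1) hk4)
    obtain ⟨n', hn', rfl⟩ := (mem_inputSymb (by omega)).1 hy
    obtain ⟨v, hv, rfl⟩ := exists_lossy_of_reach hwf hkl hyz hkl hle.1.symm
    have hlen : ∀ c ≤ k, (startState k n (n + (W + 1))).2 c ≤ v c := fun c hc => by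
      have := (hle.2 (chn k c)).length_le
      simp only [encConfig, chans, List.length_replicate, val_chn hc] at this
      exact this
    have h1 := hlen 1 (by omega)
    have h0 := hlen 0 (by omega)
    rw [(startState_input n _).1] at h1
    simp only [startState, withBudget_zero, regSum_searchRegs_start (k := k) (by omega)] at h0
    have := hW n' hn' _ hv h1
    have := le_counterSum (Nat.zero_le k) v
    dsimp only at *
    omega
  · intro h s hs
    have hn : ∀ j, g n j = 1 := fun j => by
      have := h j
      have := hg n j
      omega
    obtain ⟨p, hp⟩ := exists_le_of_mem_unboundedSymb hk4 hs
    obtain ⟨T, hT, hreach⟩ := reach_large_budget hb hk hk4 hbody hn p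
    refine ⟨_, (mem_inputSymb (by omega)).2 ⟨n, le_rfl, rfl⟩, _, ?_, hp T hT⟩
    generalize startState k n T = x at hreach
    induction hreach with
    | refl => exact .refl
    | tail _ hs ih => exact ih.trans (reach_of_lossyStep hwf hs.lossyStep)

theorem primrec_replicate {α : Type*} [Primcodable α] (a : α) :
    Primrec fun n : ℕ => List.replicate n a :=
  (Primrec.list_map Primrec.list_range (Primrec.const a).to₂).of_eq fun n => by
    simp [List.map_const']

theorem primrec_inputSymb (k l : ℕ) : Primrec (inputSymb k l) := by
  refine Primrec.pair (Primrec.const _) (Primrec.fin_curry.2 ?_)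
  exact Primrec.ite (Primrec.eq.comp Primrec.snd (Primrec.const _))
    ((primrec_replicate _).comp Primrec.fst) (Primrec.const [])

theorem primrec_unboundedSymb (k l : ℕ) : Primrec (unboundedSymb k l) := by
  refine Primrec.pair (Primrec.const _) (Primrec.fin_curry.2 ?_)
  refine Primrec.ite (Primrec.eq.comp Primrec.snd (Primrec.const _))
    ((primrec_replicate _).comp Primrec.fst) ?_
  exact Primrec.ite (Primrec.eq.comp Primrec.snd (Primrec.const _)) (Primrec.const _)
    (Primrec.const [])

/-- If the clover of the completion of a channel system is recursive, then, for primitive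
recursive families of symbolic states `σ n` and `τ n`, it is decidable whether `τ n` is contained
in the cover of `σ n`. -/
theorem computablePred_of_isSetRecursiveVia_clover {q k m : ℕ} (M : FLCS q k m)
    (hM : IsSetRecursiveVia (wordProductRep q k m) M.toFunctionalTS.completion.clover)
    {σ τ : ℕ → SymbConfig q k m} (hσ : Primrec σ) (hτ : Primrec τ) :
    ComputablePred fun n =>
      ((τ n).toIdeal : Set _) ⊆ M.toFunctionalTS.coverOfIdeal (σ n).toIdeal := by
  obtain ⟨φ, hφ, hφM⟩ := hM
  let test : ℕ → List ℕ → Bool := fun n l =>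
    l.foldr (fun e b => ((decodeSymb q k m e).map (symbIncl (τ n))).getD false || b) false
  have htest : Primrec₂ test := by
    refine Primrec.list_foldr (h := fun (p : ℕ × List ℕ) (x : ℕ × Bool) =>
      ((decodeSymb q k m x.1).map (symbIncl (τ p.1))).getD false || x.2)
      Primrec.snd (Primrec.const false) ?_
    refine Primrec.or.comp (Primrec.option_getD.comp (Primrec.option_map
      (primrec_decodeSymb.comp (Primrec.fst.comp Primrec.snd)) ?_) (Primrec.const false))
      (Primrec.snd.comp Primrec.snd)
    exact primrec_symbIncl.comp (hτ.comp (Primrec.fst.comp (Primrec.fst.comp Primrec.fst)))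
      Primrec.snd
  have htest_iff : ∀ n l, test n l = true ↔
      ∃ e ∈ l, ∃ ρ, decodeSymb q k m e = some ρ ∧ (τ n).toIdeal ≤ ρ.toIdeal := by
    intro n l
    induction l with
    | nil => simp [test]
    | cons e l ih =>
      simp only [test, List.foldr_cons, Bool.or_eq_true, List.mem_cons, exists_eq_or_imp] at ih ⊢
      rw [ih]
      refine or_congr ?_ Iff.rfl
      cases decodeSymb q k m e <;> simp [symbIncl_iff]
  have hpart : Partrec fun n => (φ (encodeSymb (σ n))).map (test n) :=
    (hφ.comp (primrec_encodeSymb.comp hσ).to_comp).map htest.to_comp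
  classical
  refine ⟨inferInstance, hpart.of_eq fun n => ?_⟩
  obtain ⟨l, hl, hdom, hset⟩ := hφM _ _ (toIdeal_mem_wordProductRep (σ n))
  refine Part.eq_some_iff.2 (Part.mem_map_iff _ |>.2 ⟨l, hl, ?_⟩)
  rw [Bool.eq_iff_iff, htest_iff, decide_eq_true_iff]
  beta_reduce
  rw [← M.toFunctionalTS.exists_le_mem_clover_completion, ← hset]
  constructor
  · rintro ⟨e, he, ρ, hρ, hle⟩
    exact ⟨_, ⟨e, he, mem_wordProductRep.2 ⟨ρ, hρ, rfl⟩⟩, hle⟩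
  · rintro ⟨J, ⟨e, he, hJ⟩, hle⟩
    obtain ⟨ρ, hρ, rfl⟩ := mem_wordProductRep.1 hJ
    exact ⟨e, he, ρ, hρ, hle⟩

open Nat.Partrec in
/-- This is `0` if the program with code `n` halts on input `0` within the resource bound `j`, and
`1` if not. -/
def haltTest (n j : ℕ) : ℕ := if (Code.evaln j (Denumerable.ofNat Code n) 0).isSome then 0 else 1

theorem primrec_haltTest : Primrec₂ haltTest := by
  have h : Primrec fun p : ℕ × ℕ =>
      Nat.Partrec.Code.evaln p.2 (Denumerable.ofNat Nat.Partrec.Code p.1) 0 :=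
    Nat.Partrec.Code.primrec_evaln.comp (((Primrec.snd).pair
      ((Primrec.ofNat _).comp Primrec.fst)).pair (Primrec.const 0))
  exact Primrec.ite (Primrec.eq.comp (Primrec.option_isSome.comp h) (Primrec.const true))
    (Primrec.const 0) (Primrec.const 1)

theorem exists_haltTest_eq_zero_iff (c : Nat.Partrec.Code) :
    (∃ j, haltTest (Encodable.encode c) j = 0) ↔ (c.eval 0).Dom := by
  rw [Part.dom_iff_mem]
  have h : ∀ j, haltTest (Encodable.encode c) j = 0 ↔ ∃ x, x ∈ c.evaln j 0 := fun j => by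
    simp only [haltTest, Denumerable.ofNat_encode, Option.mem_def, ← Option.isSome_iff_exists]
    split_ifs with h <;> simp [h]
  simp only [h, Nat.Partrec.Code.evaln_complete]
  exact exists_comm

end Clover

end WSTS

theorem mainTheorem11 :
    ∃ (q k m : ℕ) (M : WSTS.FLCS q k m),
      M.toFunctionalTS.completion.IsCompleteWSTS ∧
      M.toFunctionalTS.completion.IsEffectiveVia (WSTS.wordProductRep q k m) ∧
      ¬ WSTS.IsSetRecursiveVia (WSTS.wordProductRep q k m)
          M.toFunctionalTS.completion.clover := by
  obtain ⟨body, hb, hbody⟩ := WSTS.exists_search_body WSTS.primrec_haltTest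
  let k := max (WSTS.searchProg body).maxReg 4
  refine ⟨_, _, _, WSTS.CounterSim.toFLCS k (WSTS.searchCode k body),
    WSTS.FunctionalTS.isCompleteWSTS_completion _, WSTS.FLCS.isEffectiveVia_completion _, ?_⟩
  intro hrec
  have hg : ∀ n j, WSTS.haltTest n j ≤ 1 := fun n j => by
    unfold WSTS.haltTest
    split_ifs <;> omega
  have h := WSTS.computablePred_of_isSetRecursiveVia_clover _ hrec
    (WSTS.primrec_inputSymb k (WSTS.searchCode k body).length)
    (WSTS.primrec_unboundedSymb k (WSTS.searchCode k body).length)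
  obtain ⟨f, hf, heq⟩ := ComputablePred.computable_iff.1 h.not
  refine ComputablePred.halting_problem 0 (ComputablePred.computable_iff.2
    ⟨fun c => f (Encodable.encode c), hf.comp Computable.encode, funext fun c => ?_⟩)
  rw [← congrFun heq, WSTS.unboundedSymb_subset_cover_iff hb (le_max_left _ _) (le_max_right _ _)
    hbody hg, ← WSTS.exists_haltTest_eq_zero_iff]
  simp
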